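/- Let $\sigma_0=I$ and let $\sigma_1,\sigma_2,\sigma_3$ be the Pauli matrices. A channel is a completely positive trace-preserving (CPT) map $\Phi:M_{d_A}(\mathbb C)\to M_{d_B}(\mathbb C)$; if $\Phi(\rho)=\mathrm{Tr}_E\,U\rho U^\dagger$ with an isometry $U:\mathbb C^{d_A}\to\mathbb C^{d_B}\otimes\mathbb C^{d_E}$, then $\Phi^C(\rho)=\mathrm{Tr}_B\,U\rho U^\dagger$ is called a complement of $\Phi$. The channel $\Phi$ is anti-degradable if there is a CPT map $\Psi$ with $\Psi\circ\Phi^C=\Phi$ for some complement $\Phi^C$ (equivalently, for every complement). A unital qubit channel is a CPT map $\Phi:M_2(\mathbb C)\to M_2(\mathbb C)$ with $\Phi(I)=I$. (1) Let $a_0,a_1,a_2,a_3$ be real with $a_0\ge a_k\ge 0$ for $k=1,2,3$ and $\sum_{k=0}^3a_k^2=1$. The unital qubit channel $\Phi(\rho)=\sum_{k=0}^3a_k^2\,\sigma_k\rho\,\sigma_k$, with Kraus operators $a_k\sigma_k$, is anti-degradable if and only if $$a_1^2+a_2^2+a_3^2+a_1a_2+a_1a_3+a_2a_3\ \ge\ \tfrac12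 .$$ (2) Say that a linear map $\Phi:M_2(\mathbb C)\to M_2(\mathbb C)$ is represented by multipliers $\lambda_1,\lambda_2,\lambda_3\in\mathbb R$ if there are unitary $2\times2$ matrices $U,V$ with $$\Phi\Big(V\,\tfrac12\big[I+\textstyle\sum_kw_k\sigma_k\big]V^\dagger\Big)=U\,\tfrac12\big[I+\textstyle\sum_k\lambda_kw_k\sigma_k\big]U^\dagger\qquad\text{for all }w\in\mathbb R^3 .$$ Consider, with $\{i,j,k\}=\{1,2,3\}$ throughout, the CP condition $$(1+\lambda_k)^2\ge(\lambda_i+\lambda_j)^2\quad\text{and}\quad(1-\lambda_k)^2\ge(\lambda_i-\lambda_j)^2\qquad\text{for }k=1,2,3$$ and the condition $$\sum_{k=1}^3\Big(1-|\lambda_k|+\sqrt{(1-|\lambda_k|)^2-(|\lambda_i|-|\lambda_j|)^2}\,\Big)\ \ge\ 2 ,\tag{$*$}$$ in which, under the CP condition, the quantities under the square roots are nonnegative. A unital qubit channel is anti-degradable if and only if it can be represented by multipliers that satisfy the CP condition and $(*)$. Moreover, for every $\Phi$ represented by multipliers $\lambda_k$ that satisfy the CP condition, $\Phi$ is anti-degradable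 if and only if these $\lambda_k$ satisfy $(*)$. -/

import Mathlib

open scoped Matrix ComplexOrder

noncomputable section

namespace QubitChannel

/-- The algebra of `d × d` complex matrices. -/
abbrev Mat (d : ℕ) : Type := Matrix (Fin d) (Fin d) ℂ

/-- The map `id ⊗ Φ`, which applies `Φ` to every `m × m` block of a `k × k` block matrix. -/
def ampliation {m n : ℕ} (Φ : Mat m →ₗ[ℂ] Mat n) (k : ℕ)
    (X : Matrix (Fin k × Fin m) (Fin k × Fin m) ℂ) :
    Matrix (Fin k × Fin n) (Fin k × Fin n) ℂ :=
  Matrix.of fun p q => Φ (Matrix.of fun c d => X (p.1, c) (q.1, d)) p.2 q.2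

/-- Complete positivity: `id_k ⊗ Φ` preserves positive semidefiniteness for every `k`. -/
def IsCompletelyPositive {m n : ℕ} (Φ : Mat m →ₗ[ℂ] Mat n) : Prop :=
  ∀ (k : ℕ) (X : Matrix (Fin k × Fin m) (Fin k × Fin m) ℂ),
    X.PosSemidef → (ampliation Φ k X).PosSemidef

/-- A quantum channel: a completely positive trace-preserving (CPT) linear map. -/
structure IsChannel {m n : ℕ} (Φ : Mat m →ₗ[ℂ] Mat n) : Prop where
  completelyPositive : IsCompletelyPositive Φ
  tracePreserving : ∀ ρ : Mat m, (Φ ρ).trace = ρ.trace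

/-- A unital qubit channel: a CPT map on `2 × 2` matrices which fixes the identity. -/
structure IsUnitalQubitChannel (Φ : Mat 2 →ₗ[ℂ] Mat 2) : Prop where
  isChannel : IsChannel Φ
  unital : Φ 1 = 1

/-- The partial trace over the environment (the second tensor factor). -/
def traceEnv {b e : ℕ} (X : Matrix (Fin b × Fin e) (Fin b × Fin e) ℂ) : Mat b :=
  Matrix.of fun i j => ∑ s, X (i, s) (j, s)

/-- The partial trace over the output space (the first tensor factor). -/
def traceOut {b e : ℕ} (X : Matrix (Fin b × Fin e) (Fin b × Fin e) ℂ) : Mat e :=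
  Matrix.of fun s t => ∑ i, X (i, s) (i, t)

/-- `Φc` is a complementary channel of `Φ`: for some isometry `U : ℂ^a → ℂ^b ⊗ ℂ^e`, one has
`Φ ρ = Tr_E (U ρ U†)` and `Φc ρ = Tr_B (U ρ U†)`. -/
def IsComplement {a b e : ℕ} (Φ : Mat a →ₗ[ℂ] Mat b) (Φc : Mat a →ₗ[ℂ] Mat e) : Prop :=
  ∃ U : Matrix (Fin b × Fin e) (Fin a) ℂ, Uᴴ * U = 1 ∧
    (∀ ρ, Φ ρ = traceEnv (U * ρ * Uᴴ)) ∧ (∀ ρ, Φc ρ = traceOut (U * ρ * Uᴴ))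

/-- `Φ` is anti-degradable: there are a complementary channel `Φc` of `Φ` and a CPT map `Ψ` with
`Ψ ∘ Φc = Φ`.  Two complements of the same channel are carried to each other by partial isometries
of the environments, so this does not depend on the complement that is used. -/
def IsAntiDegradable {a b : ℕ} (Φ : Mat a →ₗ[ℂ] Mat b) : Prop :=
  ∃ (e : ℕ) (Φc : Mat a →ₗ[ℂ] Mat e), IsComplement Φ Φc ∧
    ∃ Ψ : Mat e →ₗ[ℂ] Mat b, IsChannel Ψ ∧ Ψ ∘ₗ Φc = Φ

/-- The identity and the three Pauli matrices `σ_0 = I, σ_1, σ_2, σ_3`. -/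
def pauli : Fin 4 → Mat 2 :=
  ![1, !![0, 1; 1, 0], !![0, -Complex.I; Complex.I, 0], !![1, 0; 0, -1]]

/-- `Φ` has the Kraus operators `A_k`, i.e. `Φ ρ = ∑ k, A_k ρ A_k†`. -/
def HasKraus {a b : ℕ} {κ : Type} [Fintype κ] (Φ : Mat a →ₗ[ℂ] Mat b)
    (A : κ → Matrix (Fin b) (Fin a) ℂ) : Prop :=
  ∀ ρ, Φ ρ = ∑ k, A k * ρ * (A k)ᴴ

/-- The matrix `(I + w_1 σ_1 + w_2 σ_2 + w_3 σ_3) / 2`; the index `k : Fin 3` stands for `k + 1`. -/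
def bloch (w : Fin 3 → ℝ) : Mat 2 :=
  (1 / 2 : ℂ) • (1 + ∑ k : Fin 3, (w k : ℂ) • pauli k.succ)

/-- `Φ` is represented by the multipliers `l_1, l_2, l_3`: up to unitary conjugations `V` on the
input and `U` on the output, it acts by
`(I + ∑ k, w_k σ_k) / 2 ↦ (I + ∑ k, l_k w_k σ_k) / 2`. -/
def HasMultipliers (Φ : Mat 2 →ₗ[ℂ] Mat 2) (l : Fin 3 → ℝ) : Prop :=
  ∃ U ∈ Matrix.unitaryGroup (Fin 2) ℂ, ∃ V ∈ Matrix.unitaryGroup (Fin 2) ℂ,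
    ∀ w : Fin 3 → ℝ, Φ (V * bloch w * Vᴴ) = U * bloch (fun k => l k * w k) * Uᴴ

/-- The condition `(1 ± l_k)² ≥ (l_i ± l_j)²`, for both choices of the common sign and for
`{i, j, k} = {1, 2, 3}`.  In `Fin 3`, the two indices other than `k` are `k + 1` and `k + 2`. -/
def CPCondition (l : Fin 3 → ℝ) : Prop :=
  ∀ k : Fin 3, (l (k + 1) + l (k + 2)) ^ 2 ≤ (1 + l k) ^ 2 ∧
    (l (k + 1) - l (k + 2)) ^ 2 ≤ (1 - l k) ^ 2

/-- The sum over `k` of `1 - |l_k| + √((1 - |l_k|)² - (|l_i| - |l_j|)²)`, `{i, j, k} = {1, 2, 3}`.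
Under `CPCondition l` the arguments of the square roots are nonnegative. -/
def multiplierSum (l : Fin 3 → ℝ) : ℝ :=
  ∑ k : Fin 3, (1 - |l k| + √((1 - |l k|) ^ 2 - (|l (k + 1)| - |l (k + 2)|) ^ 2))

end QubitChannel

end

/-! Everything reduces to one geometric criterion: a Pauli channel with Kraus operators `a k • pauli
k` is anti-degradable exactly when the `a k` are the side lengths of a closed quadrilateral.

Sufficiency (`isAntiDegradable_of_isQuadrilateral`): phases turn the `a k` into complex numbers with
`x 0 = x 1 + x 2 + x 3`. The operator `∑ x_k σ_k ⊗ σ_k` has eigenvalue `x 0 - x 1 - x 2 - x 3 = 0`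
on the singlet, so its range lies in the symmetric subspace. Sending the environment state `|k⟩` to
the Bell state of `σ_k` realises this operator, and the two output qubits therefore have equal
reduced states.

Necessity (`isQuadrilateral_of_gram`): a degrading map yields a positive matrix on reference, output
and second output, both of whose marginals with the reference are the Choi matrix. A component along
a Bell state of one pair is half a sum of four unitarily rotated components along Bell states of the
other pair. The lengths of all these vectors are `2 * a k`, so the triangle inequality is the
polygon inequality.

The rest is translation. When `a 0` is the largest side, one squared inequality remains, which is
the Kraus criterion. Multipliers determine the weights `a k ^ 2` linearly; the CP condition says
that the weights are nonnegative, and the multiplier sum encodes the same polygon inequality. A real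
singular value decomposition on Bloch vectors supplies multipliers for every unital qubit channel.
-/

noncomputable section

namespace QubitChannel

/-! ### Channels in Kraus form and unitary equivalence -/

/-- The map `ρ ↦ ∑ k, A_k ρ A_k†`. -/
def krausMap {a b : ℕ} {κ : Type} [Fintype κ] (A : κ → Matrix (Fin b) (Fin a) ℂ) :
    Mat a →ₗ[ℂ] Mat b where
  toFun ρ := ∑ k, A k * ρ * (A k)ᴴ
  map_add' ρ τ := by simp [Matrix.mul_add, Matrix.add_mul, Finset.sum_add_distrib]
  map_smul' c ρ := by simp [Finset.smul_sum, Matrix.mul_smul, Matrix.smul_mul]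

theorem krausMap_apply {a b : ℕ} {κ : Type} [Fintype κ] (A : κ → Matrix (Fin b) (Fin a) ℂ)
    (ρ : Mat a) : krausMap A ρ = ∑ k, A k * ρ * (A k)ᴴ := rfl

theorem krausMap_isCompletelyPositive {a b : ℕ} {κ : Type} [Fintype κ]
    (A : κ → Matrix (Fin b) (Fin a) ℂ) : IsCompletelyPositive (krausMap A) := by
  intro k X hX
  have key : ampliation (krausMap A) k X =
      ∑ j, (Matrix.of fun (p : Fin k × Fin b) (q : Fin k × Fin a) =>
          if p.1 = q.1 then A j p.2 q.2 else 0) * X *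
        (Matrix.of fun (p : Fin k × Fin b) (q : Fin k × Fin a) =>
          if p.1 = q.1 then A j p.2 q.2 else 0)ᴴ := by
    ext p q
    simp only [ampliation, krausMap_apply, Matrix.of_apply, Matrix.sum_apply, Matrix.mul_apply,
      Matrix.conjTranspose_apply, Fintype.sum_prod_type, ite_mul, zero_mul]
    refine Finset.sum_congr rfl fun j _ => ?_
    simp only [apply_ite star, star_zero, mul_ite, mul_zero]
    simp [Finset.sum_ite_eq]
  rw [key]
  exact Matrix.posSemidef_sum _ fun j _ => hX.mul_mul_conjTranspose_same _

theorem krausMap_isChannel {a b : ℕ} {κ : Type} [Fintype κ]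
    {A : κ → Matrix (Fin b) (Fin a) ℂ} (hA : ∑ k, (A k)ᴴ * A k = 1) :
    IsChannel (krausMap A) where
  completelyPositive := krausMap_isCompletelyPositive A
  tracePreserving ρ := by
    have : ∀ k, (A k * ρ * (A k)ᴴ).trace = ((A k)ᴴ * A k * ρ).trace := fun k => by
      rw [Matrix.trace_mul_comm, ← Matrix.mul_assoc]
    rw [krausMap_apply, Matrix.trace_sum, Finset.sum_congr rfl fun k _ => this k,
      ← Matrix.trace_sum, ← Finset.sum_mul, hA, one_mul]

theorem IsCompletelyPositive.comp {l m n : ℕ} {Φ : Mat m →ₗ[ℂ] Mat n} {Ψ : Mat l →ₗ[ℂ] Mat m}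
    (hΦ : IsCompletelyPositive Φ) (hΨ : IsCompletelyPositive Ψ) :
    IsCompletelyPositive (Φ ∘ₗ Ψ) :=
  fun k X hX => hΦ k _ (hΨ k X hX)

theorem IsChannel.comp {l m n : ℕ} {Φ : Mat m →ₗ[ℂ] Mat n} {Ψ : Mat l →ₗ[ℂ] Mat m}
    (hΦ : IsChannel Φ) (hΨ : IsChannel Ψ) : IsChannel (Φ ∘ₗ Ψ) where
  completelyPositive := hΦ.completelyPositive.comp hΨ.completelyPositive
  tracePreserving ρ := by
    rw [LinearMap.comp_apply, hΦ.tracePreserving, hΨ.tracePreserving]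

/-- Conjugation `ρ ↦ W ρ W†`. -/
def conjBy {a b : ℕ} (W : Matrix (Fin b) (Fin a) ℂ) : Mat a →ₗ[ℂ] Mat b :=
  krausMap fun _ : Unit => W

@[simp]
theorem conjBy_apply {a b : ℕ} (W : Matrix (Fin b) (Fin a) ℂ) (ρ : Mat a) :
    conjBy W ρ = W * ρ * Wᴴ := by
  simp [conjBy, krausMap_apply]

theorem conjBy_isChannel {a : ℕ} {W : Mat a} (hW : Wᴴ * W = 1) : IsChannel (conjBy W) :=
  krausMap_isChannel (by simpa using hW)

/-- The matrix `W ⊗ 1` with an identity on the environment. -/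
def tensorOne {b : ℕ} (e : ℕ) (W : Mat b) : Matrix (Fin b × Fin e) (Fin b × Fin e) ℂ :=
  Matrix.of fun p q => if p.2 = q.2 then W p.1 q.1 else 0

theorem conj_mul_apply {b e a : ℕ} (Y : Matrix (Fin b × Fin e) (Fin a) ℂ) (ρ : Mat a)
    (p q : Fin b × Fin e) :
    (Y * ρ * Yᴴ) p q = ∑ c, ∑ d, Y p d * ρ d c * star (Y q c) := by
  simp [Matrix.mul_apply, Finset.sum_mul]

theorem tensorOne_conjTranspose_mul {b e : ℕ} {W : Mat b} (hW : Wᴴ * W = 1) :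
    (tensorOne e W)ᴴ * tensorOne e W = 1 := by
  ext ⟨i, s⟩ ⟨j, t⟩
  have h := congrFun (congrFun hW i) j
  simp only [Matrix.mul_apply, Matrix.conjTranspose_apply] at h
  simp only [tensorOne, Matrix.mul_apply, Matrix.conjTranspose_apply, Matrix.of_apply,
    Fintype.sum_prod_type, apply_ite star, star_zero, ite_mul, zero_mul, mul_ite, mul_zero]
  simp only [Finset.sum_ite_eq', Finset.mem_univ, if_true]
  by_cases hst : s = t
  · subst hst
    simpa [Matrix.one_apply] using h
  · simp [hst, eq_comm]

theorem traceEnv_tensorOne {b e : ℕ} (W : Mat b) (X : Matrix (Fin b × Fin e) (Fin b × Fin e) ℂ) :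
    traceEnv (tensorOne e W * X * (tensorOne e W)ᴴ) = W * traceEnv X * Wᴴ := by
  ext i j
  simp only [traceEnv, tensorOne, Matrix.mul_apply, Matrix.conjTranspose_apply, Matrix.of_apply,
    Fintype.sum_prod_type, apply_ite star, star_zero, ite_mul, zero_mul, mul_ite, mul_zero,
    Finset.sum_ite_eq, Finset.mem_univ, if_true, Finset.sum_mul, Finset.mul_sum]
  rw [Finset.sum_comm]
  refine Finset.sum_congr rfl fun c _ => ?_
  rw [Finset.sum_comm]

theorem traceOut_tensorOne {b e : ℕ} {W : Mat b} (hW : Wᴴ * W = 1)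
    (X : Matrix (Fin b × Fin e) (Fin b × Fin e) ℂ) :
    traceOut (tensorOne e W * X * (tensorOne e W)ᴴ) = traceOut X := by
  ext s t
  have h : ∀ i j, ∑ c, star (W c i) * W c j = if i = j then 1 else 0 := fun i j => by
    have := congrFun (congrFun hW i) j
    simpa [Matrix.mul_apply, Matrix.one_apply] using this
  simp only [traceOut, tensorOne, Matrix.mul_apply, Matrix.conjTranspose_apply, Matrix.of_apply,
    Fintype.sum_prod_type, apply_ite star, star_zero, ite_mul, zero_mul, mul_ite, mul_zero,
    Finset.sum_ite_eq, Finset.mem_univ, if_true, Finset.sum_mul]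
  rw [Finset.sum_comm]
  have : ∀ y, (∑ x, ∑ i, W x i * X (i, s) (y, t) * star (W x y)) = X (y, s) (y, t) := by
    intro y
    rw [Finset.sum_comm]
    calc _ = ∑ i, (∑ x, star (W x y) * W x i) * X (i, s) (y, t) := by
          refine Finset.sum_congr rfl fun i _ => ?_
          rw [Finset.sum_mul]
          exact Finset.sum_congr rfl fun x _ => by ring
      _ = _ := by simp only [h]; simp
  exact Finset.sum_congr rfl fun y _ => this y

/-- Anti-degradability is preserved by unitary conjugations of the input and the output. -/
theorem IsAntiDegradable.unitary {a b : ℕ} {Φ Φ' : Mat a →ₗ[ℂ] Mat b} {U : Mat b} {V : Mat a}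
    (hU : Uᴴ * U = 1) (hV : Vᴴ * V = 1) (hΦ' : ∀ ρ, Φ' ρ = U * Φ (V * ρ * Vᴴ) * Uᴴ)
    (h : IsAntiDegradable Φ) : IsAntiDegradable Φ' := by
  obtain ⟨e, Φc, ⟨W, hW, hΦ, hΦc⟩, Ψ, hΨ, hcomp⟩ := h
  have harr : ∀ ρ : Mat a, tensorOne e U * W * V * ρ * (tensorOne e U * W * V)ᴴ =
      tensorOne e U * (W * (V * ρ * Vᴴ) * Wᴴ) * (tensorOne e U)ᴴ := fun ρ => by
    simp only [Matrix.conjTranspose_mul, Matrix.mul_assoc]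
  -- The output unitary disappears from the complement when the output is traced out; it is restored
  -- after the degrading map.
  refine ⟨e, Φc ∘ₗ conjBy V, ⟨tensorOne e U * W * V, ?_, fun ρ => ?_, fun ρ => ?_⟩,
    conjBy U ∘ₗ Ψ, (conjBy_isChannel hU).comp hΨ, ?_⟩
  · calc _ = Vᴴ * (Wᴴ * ((tensorOne e U)ᴴ * tensorOne e U) * W) * V := by
          simp only [Matrix.conjTranspose_mul, Matrix.mul_assoc]
      _ = 1 := by rw [tensorOne_conjTranspose_mul hU, Matrix.mul_one, hW, Matrix.mul_one, hV]
  · rw [harr, traceEnv_tensorOne, hΦ', hΦ]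
  · rw [harr, traceOut_tensorOne hU, LinearMap.comp_apply, conjBy_apply, hΦc]
  · ext1 ρ
    have := LinearMap.congr_fun hcomp (V * ρ * Vᴴ)
    simp only [LinearMap.comp_apply] at this
    simp [hΦ', this]

/-! ### Pauli matrices -/

theorem pauli_conjTranspose (k : Fin 4) : (pauli k)ᴴ = pauli k := by
  fin_cases k <;> ext i j <;> fin_cases i <;> fin_cases j <;> simp [pauli]

theorem pauli_mul_self (k : Fin 4) : pauli k * pauli k = 1 := by
  fin_cases k <;> ext i j <;> fin_cases i <;> fin_cases j <;>
    simp [pauli, Matrix.one_apply, Matrix.mul_apply, Fin.sum_univ_two]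

theorem eq_sum_pauli (ρ : Mat 2) :
    ρ = ((ρ 0 0 + ρ 1 1) / 2) • pauli 0 + ((ρ 0 1 + ρ 1 0) / 2) • pauli 1 +
      (Complex.I * (ρ 0 1 - ρ 1 0) / 2) • pauli 2 + ((ρ 0 0 - ρ 1 1) / 2) • pauli 3 := by
  ext i j
  fin_cases i <;> fin_cases j <;> simp [pauli] <;> ring_nf <;> simp <;> ring

/-- Two linear maps that agree on the Pauli matrices are equal. -/
theorem linearMap_ext_pauli {n : ℕ} {Φ Ψ : Mat 2 →ₗ[ℂ] Mat n}
    (h : ∀ k, Φ (pauli k) = Ψ (pauli k)) : Φ = Ψ := by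
  ext1 ρ
  rw [eq_sum_pauli ρ]
  simp only [map_add, map_smul, h]

/-- The Pauli channel `ρ ↦ ∑ k, p_k σ_k ρ σ_k`. -/
def pauliMap (p : Fin 4 → ℝ) : Mat 2 →ₗ[ℂ] Mat 2 where
  toFun ρ := ∑ k, (p k : ℂ) • (pauli k * ρ * pauli k)
  map_add' ρ τ := by simp [mul_add, add_mul, Finset.sum_add_distrib]
  map_smul' c ρ := by
    simp [Finset.smul_sum, smul_comm c]

theorem pauliMap_apply (p : Fin 4 → ℝ) (ρ : Mat 2) :
    pauliMap p ρ = ∑ k, (p k : ℂ) • (pauli k * ρ * pauli k) := rfl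

theorem pauliMap_entry (p : Fin 4 → ℝ) (c d i j : Fin 2) :
    pauliMap p (Matrix.single c d 1) i j = ∑ k, p k * (pauli k i c * star (pauli k j d)) := by
  have h : ∀ k, pauli k d j = star (pauli k j d) := fun k => by
    rw [← Matrix.conjTranspose_apply, pauli_conjTranspose]
  simp only [pauliMap_apply, Matrix.sum_apply, Matrix.smul_apply, smul_eq_mul, ← h]
  refine Finset.sum_congr rfl fun k _ => ?_
  rw [Matrix.mul_assoc, Matrix.mul_apply]
  simp [Matrix.mul_apply, Matrix.single_apply, ite_and]

/-- The weights of the Pauli channel with multipliers `l`. -/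
def pauliWeights (l : Fin 3 → ℝ) : Fin 4 → ℝ :=
  ![(1 + l 0 + l 1 + l 2) / 4, (1 + l 0 - l 1 - l 2) / 4, (1 - l 0 + l 1 - l 2) / 4,
    (1 - l 0 - l 1 + l 2) / 4]

theorem sum_pauliWeights (l : Fin 3 → ℝ) : ∑ k, pauliWeights l k = 1 := by
  simp [pauliWeights, Fin.sum_univ_four]
  ring

theorem pauliMap_pauliWeights_one (l : Fin 3 → ℝ) : pauliMap (pauliWeights l) 1 = 1 := by
  simp only [pauliMap_apply, mul_one, pauli_mul_self, ← Finset.sum_smul, ← Complex.ofReal_sum,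
    sum_pauliWeights, Complex.ofReal_one, one_smul]

theorem pauliMap_pauliWeights_pauli (l : Fin 3 → ℝ) (k : Fin 3) :
    pauliMap (pauliWeights l) (pauli k.succ) = (l k : ℂ) • pauli k.succ := by
  rw [pauliMap_apply]
  fin_cases k <;> ext i j <;> fin_cases i <;> fin_cases j <;>
    simp [pauli, Fin.sum_univ_four, pauliWeights] <;> ring

theorem bloch_single (k : Fin 3) : bloch (Pi.single k 1) = (1 / 2 : ℂ) • (1 + pauli k.succ) := by
  simp [bloch, Pi.single_apply, apply_ite Complex.ofReal, ite_smul]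

/-- A linear map which acts on Bloch vectors by multipliers is a Pauli channel. -/
theorem eq_pauliMap_of_bloch {Φ : Mat 2 →ₗ[ℂ] Mat 2} {l : Fin 3 → ℝ}
    (h : ∀ w, Φ (bloch w) = bloch fun k => l k * w k) : Φ = pauliMap (pauliWeights l) := by
  have h0 : Φ 1 = 1 := by
    have := h 0
    simpa [bloch] using this
  apply linearMap_ext_pauli
  intro k
  refine Fin.cases ?_ (fun k => ?_) k
  · simp only [pauli, Matrix.cons_val_zero]
    rw [h0, pauliMap_pauliWeights_one]
  · rw [pauliMap_pauliWeights_pauli]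
    have h1 := h (Pi.single k 1)
    have h2 : bloch (fun j => l j * (Pi.single k 1 : Fin 3 → ℝ) j) =
        (1 / 2 : ℂ) • (1 + (l k : ℂ) • pauli k.succ) := by
      simp [bloch, Pi.single_apply, apply_ite Complex.ofReal, ite_smul]
    rw [h2, bloch_single, map_smul, map_add, h0] at h1
    have := smul_right_injective (Mat 2) (by norm_num : (1 / 2 : ℂ) ≠ 0) h1
    exact add_left_cancel this

theorem HasMultipliers.exists_pauliMap {Φ : Mat 2 →ₗ[ℂ] Mat 2} {l : Fin 3 → ℝ}
    (h : HasMultipliers Φ l) : ∃ U V : Mat 2, Uᴴ * U = 1 ∧ U * Uᴴ = 1 ∧ Vᴴ * V = 1 ∧ V * Vᴴ = 1 ∧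
      (∀ ρ, pauliMap (pauliWeights l) ρ = Uᴴ * Φ (V * ρ * Vᴴ) * U) ∧
      ∀ ρ, Φ ρ = U * pauliMap (pauliWeights l) (Vᴴ * ρ * V) * Uᴴ := by
  obtain ⟨U, hU, V, hV, hw⟩ := h
  have hU1 : Uᴴ * U = 1 := Matrix.mem_unitaryGroup_iff'.1 hU
  have hU2 : U * Uᴴ = 1 := Matrix.mem_unitaryGroup_iff.1 hU
  have hV1 : Vᴴ * V = 1 := Matrix.mem_unitaryGroup_iff'.1 hV
  have hV2 : V * Vᴴ = 1 := Matrix.mem_unitaryGroup_iff.1 hV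
  have key : conjBy Uᴴ ∘ₗ Φ ∘ₗ conjBy V = pauliMap (pauliWeights l) := by
    apply eq_pauliMap_of_bloch
    intro w
    simp only [LinearMap.comp_apply, conjBy_apply, hw, Matrix.conjTranspose_conjTranspose]
    calc _ = (Uᴴ * U) * bloch (fun k => l k * w k) * (Uᴴ * U) := by
          simp only [Matrix.mul_assoc]
      _ = _ := by rw [hU1, one_mul, mul_one]
  have key' : ∀ ρ, pauliMap (pauliWeights l) ρ = Uᴴ * Φ (V * ρ * Vᴴ) * U := fun ρ => by
    rw [← key]
    simp
  refine ⟨U, V, hU1, hU2, hV1, hV2, key', fun ρ => ?_⟩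
  rw [key']
  calc Φ ρ = (U * Uᴴ) * Φ ((V * Vᴴ) * ρ * (V * Vᴴ)) * (U * Uᴴ) := by simp [hU2, hV2]
    _ = _ := by simp only [Matrix.mul_assoc]

theorem isAntiDegradable_iff_pauliMap {Φ : Mat 2 →ₗ[ℂ] Mat 2} {l : Fin 3 → ℝ}
    (h : HasMultipliers Φ l) :
    IsAntiDegradable Φ ↔ IsAntiDegradable (pauliMap (pauliWeights l)) := by
  obtain ⟨U, V, hU1, hU2, hV1, hV2, h1, h2⟩ := HasMultipliers.exists_pauliMap h
  constructor
  · exact IsAntiDegradable.unitary (U := Uᴴ) (V := V) (by simpa using hU2) hV1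
      (by simpa using h1)
  · exact IsAntiDegradable.unitary (U := U) (V := Vᴴ) hU1 (by simpa using hV2)
      (by simpa using h2)

/-! ### The complete positivity condition -/

/-- The unnormalised maximally entangled state. -/
def entangled : Matrix (Fin 2 × Fin 2) (Fin 2 × Fin 2) ℂ :=
  Matrix.vecMulVec (fun p => if p.1 = p.2 then 1 else 0)
    (star fun p => if p.1 = p.2 then 1 else 0)

theorem entangled_posSemidef : entangled.PosSemidef :=
  Matrix.posSemidef_vecMulVec_self_star _

theorem ampliation_entangled {n : ℕ} (Φ : Mat 2 →ₗ[ℂ] Mat n) (p q : Fin 2 × Fin n) :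
    ampliation Φ 2 entangled p q = Φ (Matrix.single p.1 q.1 1) p.2 q.2 := by
  have h : (Matrix.of fun c d => entangled (p.1, c) (q.1, d)) = Matrix.single p.1 q.1 1 := by
    ext c d
    by_cases h1 : p.1 = c <;> by_cases h2 : q.1 = d <;>
      simp [entangled, Matrix.vecMulVec, h1, h2]
  simp only [ampliation, Matrix.of_apply, h]

/-- The Bell vector of `σ_k` is an eigenvector of the Choi matrix; the quadratic form there equals
`4 * p k`. -/
theorem weights_nonneg_of_completelyPositive {p : Fin 4 → ℝ}
    (h : IsCompletelyPositive (pauliMap p)) (k : Fin 4) : 0 ≤ p k := by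
  have hX := (h 2 _ entangled_posSemidef).dotProduct_mulVec_nonneg fun x => pauli k x.2 x.1
  simp only [Matrix.mulVec, dotProduct, ampliation_entangled, pauliMap_entry,
    Fintype.sum_prod_type, Pi.star_apply] at hX
  have : (0 : ℂ) ≤ ((4 * p k : ℝ) : ℂ) := by
    convert hX using 1
    fin_cases k <;> simp [pauli, Fin.sum_univ_four] <;> ring_nf <;> simp
  have := Complex.zero_le_real.1 this
  linarith

theorem nonneg_of_pairwise_mul_nonneg {a b c d : ℝ} (h : 0 < a + b + c + d) (hb : 0 ≤ a * b)
    (hc : 0 ≤ a * c) (hd : 0 ≤ a * d) : 0 ≤ a := by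
  by_contra! ha
  have h1 := nonpos_of_mul_nonneg_right hb ha
  have h2 := nonpos_of_mul_nonneg_right hc ha
  have h3 := nonpos_of_mul_nonneg_right hd ha
  linarith

/-- Each of the six differences of squares is 16 times a product of two distinct weights. As the
weights sum to 1, a negative one would force the other three to be nonpositive, which is absurd. -/
theorem cpCondition_iff (l : Fin 3 → ℝ) : CPCondition l ↔ ∀ k, 0 ≤ pauliWeights l k := by
  have h1 : CPCondition l ↔
      ((l 1 + l 2) ^ 2 ≤ (1 + l 0) ^ 2 ∧ (l 1 - l 2) ^ 2 ≤ (1 - l 0) ^ 2) ∧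
      ((l 2 + l 0) ^ 2 ≤ (1 + l 1) ^ 2 ∧ (l 2 - l 0) ^ 2 ≤ (1 - l 1) ^ 2) ∧
      ((l 0 + l 1) ^ 2 ≤ (1 + l 2) ^ 2 ∧ (l 0 - l 1) ^ 2 ≤ (1 - l 2) ^ 2) := by
    simp only [CPCondition, Fin.forall_fin_succ, Fin.forall_fin_zero, and_true]
    rfl
  have h2 : (∀ k, 0 ≤ pauliWeights l k) ↔ 0 ≤ (1 + l 0 + l 1 + l 2) / 4 ∧
      0 ≤ (1 + l 0 - l 1 - l 2) / 4 ∧ 0 ≤ (1 - l 0 + l 1 - l 2) / 4 ∧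
      0 ≤ (1 - l 0 - l 1 + l 2) / 4 := by
    simp only [Fin.forall_fin_succ, Fin.forall_fin_zero, and_true]
    rfl
  rw [h1, h2]
  set a := (1 + l 0 + l 1 + l 2) / 4 with ha
  set b := (1 + l 0 - l 1 - l 2) / 4 with hb
  set c := (1 - l 0 + l 1 - l 2) / 4 with hc
  set d := (1 - l 0 - l 1 + l 2) / 4 with hd
  have hab : (1 + l 0) ^ 2 - (l 1 + l 2) ^ 2 = 16 * (a * b) := by rw [ha, hb]; ring
  have hcd : (1 - l 0) ^ 2 - (l 1 - l 2) ^ 2 = 16 * (c * d) := by rw [hc, hd]; ring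
  have hac : (1 + l 1) ^ 2 - (l 2 + l 0) ^ 2 = 16 * (a * c) := by rw [ha, hc]; ring
  have hbd : (1 - l 1) ^ 2 - (l 2 - l 0) ^ 2 = 16 * (b * d) := by rw [hb, hd]; ring
  have had : (1 + l 2) ^ 2 - (l 0 + l 1) ^ 2 = 16 * (a * d) := by rw [ha, hd]; ring
  have hbc : (1 - l 2) ^ 2 - (l 0 - l 1) ^ 2 = 16 * (b * c) := by rw [hb, hc]; ring
  have hsum : a + b + c + d = 1 := by rw [ha, hb, hc, hd]; ring
  clear_value a b c d
  constructor
  · rintro ⟨⟨i1, i2⟩, ⟨i3, i4⟩, ⟨i5, i6⟩⟩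
    refine ⟨nonneg_of_pairwise_mul_nonneg (b := b) (c := c) (d := d) ?_ ?_ ?_ ?_,
      nonneg_of_pairwise_mul_nonneg (b := a) (c := c) (d := d) ?_ ?_ ?_ ?_,
      nonneg_of_pairwise_mul_nonneg (b := a) (c := b) (d := d) ?_ ?_ ?_ ?_,
      nonneg_of_pairwise_mul_nonneg (b := a) (c := b) (d := c) ?_ ?_ ?_ ?_⟩ <;> linarith
  · rintro ⟨i1, i2, i3, i4⟩
    have := mul_nonneg i1 i2
    have := mul_nonneg i1 i3
    have := mul_nonneg i1 i4
    have := mul_nonneg i2 i3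
    have := mul_nonneg i2 i4
    have := mul_nonneg i3 i4
    refine ⟨⟨?_, ?_⟩, ⟨?_, ?_⟩, ⟨?_, ?_⟩⟩ <;> linarith

theorem cpCondition_of_completelyPositive {Φ : Mat 2 →ₗ[ℂ] Mat 2} {l : Fin 3 → ℝ}
    (h : HasMultipliers Φ l) (hΦ : IsCompletelyPositive Φ) : CPCondition l := by
  obtain ⟨U, V, hU1, hU2, hV1, hV2, h1, h2⟩ := HasMultipliers.exists_pauliMap h
  rw [cpCondition_iff]
  apply weights_nonneg_of_completelyPositive
  have : pauliMap (pauliWeights l) = conjBy Uᴴ ∘ₗ Φ ∘ₗ conjBy V := by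
    ext1 ρ
    simp [h1]
  rw [this]
  exact (conjBy_isChannel (by simpa using hU2)).completelyPositive.comp
    (hΦ.comp (conjBy_isChannel hV1).completelyPositive)

/-! ### The polygon inequalities -/

/-- The four numbers are the side lengths of a closed (possibly degenerate) quadrilateral. -/
def IsQuadrilateral (a : Fin 4 → ℝ) : Prop := ∀ j, 2 * a j ≤ ∑ k, a k

theorem isQuadrilateral_iff (a : Fin 4 → ℝ) : IsQuadrilateral a ↔
    a 0 ≤ a 1 + a 2 + a 3 ∧ a 1 ≤ a 0 + a 2 + a 3 ∧ a 2 ≤ a 0 + a 1 + a 3 ∧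
      a 3 ≤ a 0 + a 1 + a 2 := by
  simp only [IsQuadrilateral, Fin.forall_fin_succ, Fin.forall_fin_zero, Fin.sum_univ_four, and_true]
  constructor
  · rintro ⟨h0, h1, h2, h3⟩
    have h1 : 2 * a 1 ≤ a 0 + a 1 + a 2 + a 3 := h1
    have h2 : 2 * a 2 ≤ a 0 + a 1 + a 2 + a 3 := h2
    have h3 : 2 * a 3 ≤ a 0 + a 1 + a 2 + a 3 := h3
    refine ⟨?_, ?_, ?_, ?_⟩ <;> linarith
  · rintro ⟨h0, h1, h2, h3⟩
    refine ⟨?_, show 2 * a 1 ≤ a 0 + a 1 + a 2 + a 3 from ?_,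
      show 2 * a 2 ≤ a 0 + a 1 + a 2 + a 3 from ?_,
      show 2 * a 3 ≤ a 0 + a 1 + a 2 + a 3 from ?_⟩ <;> linarith

/-- These are triangles whose third side is the real segment of length `d`. The law of cosines gives
the projection `α` of `z` on that side. -/
theorem exists_triangle {r s d : ℝ} (hd : 0 ≤ d) (h1 : d ≤ r + s)
    (h2 : r - s ≤ d) (h3 : s - r ≤ d) :
    ∃ z w : ℂ, z * star z = (r ^ 2 : ℝ) ∧ w * star w = (s ^ 2 : ℝ) ∧ z + w = d := by
  rcases hd.eq_or_lt with rfl | hd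
  · obtain rfl : r = s := by linarith
    exact ⟨r, -r, by simp [sq], by simp [sq], by simp⟩
  · set α := (d ^ 2 + r ^ 2 - s ^ 2) / (2 * d) with hα
    have hα' : 2 * d * α = d ^ 2 + r ^ 2 - s ^ 2 := by rw [hα]; field_simp
    have hle : α ^ 2 ≤ r ^ 2 := by
      apply sq_le_sq'
      · have : 0 ≤ (2 * d) * (α + r) := by
          have : (2 * d) * (α + r) = (d + r - s) * (d + r + s) := by linear_combination hα'
          rw [this]
          apply mul_nonneg <;> linarith
        have := nonneg_of_mul_nonneg_right this (by linarith)
        linarith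
      · have : 0 ≤ (2 * d) * (r - α) := by
          have : (2 * d) * (r - α) = (s - d + r) * (s + d - r) := by linear_combination -hα'
          rw [this]
          apply mul_nonneg <;> linarith
        have := nonneg_of_mul_nonneg_right this (by linarith)
        linarith
    have hβ := Real.sq_sqrt (sub_nonneg.2 hle)
    set β := √(r ^ 2 - α ^ 2)
    have hnorm : ∀ u v : ℝ, (⟨u, v⟩ : ℂ) * star (⟨u, v⟩ : ℂ) = (u ^ 2 + v ^ 2 : ℝ) := fun u v => by
      simp [Complex.mul_conj, Complex.normSq_mk, sq]
    refine ⟨⟨α, β⟩, ⟨d - α, -β⟩, ?_, ?_, ?_⟩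
    · rw [hnorm]
      congr 1
      linarith
    · rw [hnorm]
      congr 1
      linarith
    · apply Complex.ext <;> simp

/-- Side lengths that satisfy the polygon inequalities are those of a closed quadrilateral. -/
theorem exists_quadrilateral {a : Fin 4 → ℝ} (ha : ∀ k, 0 ≤ a k) (h : IsQuadrilateral a) :
    ∃ x : Fin 4 → ℂ, (∀ k, x k * star (x k) = (a k ^ 2 : ℝ)) ∧ x 0 = x 1 + x 2 + x 3 := by
  obtain ⟨h0, h1, h2, h3⟩ := (isQuadrilateral_iff a).1 h
  have p0 := ha 0
  have p1 := ha 1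
  have p2 := ha 2
  have p3 := ha 3
  -- The quadrilateral is cut along a diagonal into two triangles. This is the shortest diagonal
  -- that both allow, and the polygon inequalities bound it by `a 0 + a 1` and `a 2 + a 3`.
  set d := max |a 0 - a 1| |a 2 - a 3|
  have hd1 : d ≤ a 0 + a 1 := by
    apply max_le <;> rw [abs_le] <;> constructor <;> linarith
  have hd2 : d ≤ a 2 + a 3 := by
    apply max_le <;> rw [abs_le] <;> constructor <;> linarith
  obtain ⟨i1, i2⟩ := abs_le.1 (le_max_left |a 0 - a 1| |a 2 - a 3|)
  obtain ⟨i3, i4⟩ := abs_le.1 (le_max_right |a 0 - a 1| |a 2 - a 3|)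
  have hd0 : 0 ≤ d := le_max_of_le_left (abs_nonneg _)
  obtain ⟨z, w, hz, hw, hzw⟩ := exists_triangle hd0 hd1 (by linarith) (by linarith)
  obtain ⟨u, v, hu, hv, huv⟩ := exists_triangle hd0 hd2 (by linarith) (by linarith)
  refine ⟨![z, -w, u, v], ?_, ?_⟩
  · intro k
    fin_cases k
    · exact hz
    · simpa using hw
    · exact hu
    · exact hv
  · simp only [Matrix.cons_val]
    linear_combination hzw - huv

/-! ### The multiplier sum as a polygon inequality -/

theorem sqrt_le_sqrt_add_sqrt {x y z : ℝ} (h : x ≤ y + z) : √x ≤ √y + √z := by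
  have hy := Real.sqrt_nonneg y
  have hz := Real.sqrt_nonneg z
  refine Real.sqrt_le_iff.2 ⟨by positivity, ?_⟩
  have := mul_nonneg hy hz
  rw [add_sq]
  have h1 : y ≤ √y ^ 2 := by rw [Real.sq_sqrt']; exact le_max_left _ _
  have h2 : z ≤ √z ^ 2 := by rw [Real.sq_sqrt']; exact le_max_left _ _
  linarith

/-- Square, then add `b ^ 2 + c ^ 2 + d ^ 2` to both sides. -/
theorem le_add_add_iff_of_sum_sq {a b c d : ℝ} (ha : 0 ≤ a) (hb : 0 ≤ b) (hc : 0 ≤ c)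
    (hd : 0 ≤ d) (h : a ^ 2 + b ^ 2 + c ^ 2 + d ^ 2 = 1) :
    a ≤ b + c + d ↔ 1 / 2 ≤ b ^ 2 + c ^ 2 + d ^ 2 + b * c + b * d + c * d := by
  rw [← sq_le_sq₀ ha (by positivity)]
  constructor <;> intro h1 <;> linarith

/-- The value of `multiplierSum` at multipliers of absolute values `x, y, z`. -/
def absMultiplierSum (x y z : ℝ) : ℝ :=
  (1 - x + √((1 - x) ^ 2 - (y - z) ^ 2)) + (1 - y + √((1 - y) ^ 2 - (z - x) ^ 2)) +
    (1 - z + √((1 - z) ^ 2 - (x - y) ^ 2))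

/-- Here `p` is the largest weight, so only its polygon inequality matters. Since `1 - x = 2 * (r +
s)` and the first root is `4 * √r * √s`, and similarly for the others, the sum is four times the
quadratic expression of `le_add_add_iff_of_sum_sq`. -/
theorem isQuadrilateral_sqrt_iff {x y z p q r s : ℝ} (hx : 0 ≤ x) (hy : 0 ≤ y) (hz : 0 ≤ z)
    (ep : 4 * p = 1 + x + y + z) (eq : 4 * q = 1 + x - y - z) (er : 4 * r = 1 - x + y - z)
    (es : 4 * s = 1 - x - y + z) (hq : 0 ≤ q) (hr : 0 ≤ r) (hs : 0 ≤ s) :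
    IsQuadrilateral ![√p, √q, √r, √s] ↔ 2 ≤ absMultiplierSum x y z := by
  have hp : 0 ≤ p := by linarith
  have m1 : √q ≤ √p := Real.sqrt_le_sqrt (by linarith)
  have m2 : √r ≤ √p := Real.sqrt_le_sqrt (by linarith)
  have m3 : √s ≤ √p := Real.sqrt_le_sqrt (by linarith)
  have s0 := Real.sq_sqrt hp
  have s1 := Real.sq_sqrt hq
  have s2 := Real.sq_sqrt hr
  have s3 := Real.sq_sqrt hs
  have n0 := Real.sqrt_nonneg p
  have n1 := Real.sqrt_nonneg q
  have n2 := Real.sqrt_nonneg r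
  have n3 := Real.sqrt_nonneg s
  rw [isQuadrilateral_iff]
  simp only [Matrix.cons_val]
  generalize √p = a at m1 m2 m3 s0 s1 s2 s3 n0 n1 n2 n3 ⊢
  generalize √q = b at m1 m2 m3 s0 s1 s2 s3 n0 n1 n2 n3 ⊢
  generalize √r = c at m1 m2 m3 s0 s1 s2 s3 n0 n1 n2 n3 ⊢
  generalize √s = d at m1 m2 m3 s0 s1 s2 s3 n0 n1 n2 n3 ⊢
  have e1 : √((1 - x) ^ 2 - (y - z) ^ 2) = 4 * (c * d) := by
    rw [show (1 - x) ^ 2 - (y - z) ^ 2 = (4 * (c * d)) ^ 2 by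
      rw [mul_pow, mul_pow, s2, s3]; linear_combination (-4 * s) * er - (1 - x + y - z) * es]
    exact Real.sqrt_sq (by positivity)
  have e2 : √((1 - y) ^ 2 - (z - x) ^ 2) = 4 * (b * d) := by
    rw [show (1 - y) ^ 2 - (z - x) ^ 2 = (4 * (b * d)) ^ 2 by
      rw [mul_pow, mul_pow, s1, s3]; linear_combination (-4 * s) * eq - (1 + x - y - z) * es]
    exact Real.sqrt_sq (by positivity)
  have e3 : √((1 - z) ^ 2 - (x - y) ^ 2) = 4 * (b * c) := by
    rw [show (1 - z) ^ 2 - (x - y) ^ 2 = (4 * (b * c)) ^ 2 by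
      rw [mul_pow, mul_pow, s1, s2]; linear_combination (-4 * r) * eq - (1 + x - y - z) * er]
    exact Real.sqrt_sq (by positivity)
  have key := le_add_add_iff_of_sum_sq n0 n1 n2 n3 (by linarith)
  rw [absMultiplierSum, e1, e2, e3, key]
  constructor
  · rintro ⟨h, -⟩
    exact (by linarith)
  · intro h
    have h' : 1 / 2 ≤ b ^ 2 + c ^ 2 + d ^ 2 + b * c + b * d + c * d := by linarith
    exact ⟨h', by linarith, by linarith, by linarith⟩

/-- Both sides are true: `0 ≤ p` means `x + y + z ≤ 1`, so the sum is at least 2 without its roots,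
and each weight is at most the sum of two others or another single one. -/
theorem isQuadrilateral_sqrt_iff_of_neg {x y z p q r s : ℝ} (hx : 0 ≤ x) (hy : 0 ≤ y)
    (hz : 0 ≤ z) (ep : 4 * p = 1 - x - y - z) (eq : 4 * q = 1 - x + y + z)
    (er : 4 * r = 1 + x - y + z) (es : 4 * s = 1 + x + y - z) (hp : 0 ≤ p) :
    IsQuadrilateral ![√p, √q, √r, √s] ↔ 2 ≤ absMultiplierSum x y z := by
  have hsum : 2 ≤ absMultiplierSum x y z := by
    have := Real.sqrt_nonneg ((1 - x) ^ 2 - (y - z) ^ 2)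
    have := Real.sqrt_nonneg ((1 - y) ^ 2 - (z - x) ^ 2)
    have := Real.sqrt_nonneg ((1 - z) ^ 2 - (x - y) ^ 2)
    rw [absMultiplierSum]
    linarith
  have n0 := Real.sqrt_nonneg p
  have n1 := Real.sqrt_nonneg q
  have n2 := Real.sqrt_nonneg r
  have n3 := Real.sqrt_nonneg s
  have i0 : √p ≤ √q := Real.sqrt_le_sqrt (by linarith)
  have i1 : √q ≤ √r + √s :=
    sqrt_le_sqrt_add_sqrt (by linarith)
  have i2 : √r ≤ √q + √s :=
    sqrt_le_sqrt_add_sqrt (by linarith)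
  have i3 : √s ≤ √q + √r :=
    sqrt_le_sqrt_add_sqrt (by linarith)
  rw [isQuadrilateral_iff]
  simp only [Matrix.cons_val, hsum, iff_true]
  refine ⟨?_, ?_, ?_, ?_⟩ <;> linarith

theorem multiplierSum_eq (l : Fin 3 → ℝ) :
    multiplierSum l = absMultiplierSum |l 0| |l 1| |l 2| := by
  rw [multiplierSum, Fin.sum_univ_three]
  rfl

/-- The sum criterion is the polygon inequality for the square roots of the weights. -/
theorem isQuadrilateral_sqrt_weights_iff {l : Fin 3 → ℝ} (h : ∀ k, 0 ≤ pauliWeights l k) :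
    IsQuadrilateral (fun k => √(pauliWeights l k)) ↔ 2 ≤ multiplierSum l := by
  have h0 := h 0
  have h1 := h 1
  have h2 := h 2
  have h3 := h 3
  have e0 : 4 * pauliWeights l 0 = 1 + l 0 + l 1 + l 2 := mul_div_cancel₀ _ four_ne_zero
  have e1 : 4 * pauliWeights l 1 = 1 + l 0 - l 1 - l 2 := mul_div_cancel₀ _ four_ne_zero
  have e2 : 4 * pauliWeights l 2 = 1 - l 0 + l 1 - l 2 := mul_div_cancel₀ _ four_ne_zero
  have e3 : 4 * pauliWeights l 3 = 1 - l 0 - l 1 + l 2 := mul_div_cancel₀ _ four_ne_zero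
  rw [multiplierSum_eq, isQuadrilateral_iff]
  generalize pauliWeights l 0 = p at *
  generalize pauliWeights l 1 = q at *
  generalize pauliWeights l 2 = r at *
  generalize pauliWeights l 3 = s at *
  have perm : ∀ {a b c d : ℝ}, IsQuadrilateral ![a, b, c, d] ↔
      a ≤ b + c + d ∧ b ≤ a + c + d ∧ c ≤ a + b + d ∧ d ≤ a + b + c := fun {a b c d} =>
    isQuadrilateral_iff _
  -- Flipping the signs of two multipliers permutes the weights. The eight sign patterns thus fall
  -- under the two preceding lemmas according to the parity of the number of negative signs.
  rcases le_total 0 (l 0) with hx | hx <;> rcases le_total 0 (l 1) with hy | hy <;>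
    rcases le_total 0 (l 2) with hz | hz <;>
    simp only [abs_of_nonneg, abs_of_nonpos, hx, hy, hz]
  · rw [← isQuadrilateral_sqrt_iff (p := p) (q := q) (r := r) (s := s), perm] <;> linarith
  · rw [← isQuadrilateral_sqrt_iff_of_neg (p := s) (q := r) (r := q) (s := p), perm]
    · constructor <;> rintro ⟨i0, i1, i2, i3⟩ <;> refine ⟨?_, ?_, ?_, ?_⟩ <;> linarith
    all_goals linarith
  · rw [← isQuadrilateral_sqrt_iff_of_neg (p := r) (q := s) (r := p) (s := q), perm]
    · constructor <;> rintro ⟨i0, i1, i2, i3⟩ <;> refine ⟨?_, ?_, ?_, ?_⟩ <;> linarith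
    all_goals linarith
  · rw [← isQuadrilateral_sqrt_iff (p := q) (q := p) (r := s) (s := r), perm]
    · constructor <;> rintro ⟨i0, i1, i2, i3⟩ <;> refine ⟨?_, ?_, ?_, ?_⟩ <;> linarith
    all_goals linarith
  · rw [← isQuadrilateral_sqrt_iff_of_neg (p := q) (q := p) (r := s) (s := r), perm]
    · constructor <;> rintro ⟨i0, i1, i2, i3⟩ <;> refine ⟨?_, ?_, ?_, ?_⟩ <;> linarith
    all_goals linarith
  · rw [← isQuadrilateral_sqrt_iff (p := r) (q := s) (r := p) (s := q), perm]
    · constructor <;> rintro ⟨i0, i1, i2, i3⟩ <;> refine ⟨?_, ?_, ?_, ?_⟩ <;> linarith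
    all_goals linarith
  · rw [← isQuadrilateral_sqrt_iff (p := s) (q := r) (r := q) (s := p), perm]
    · constructor <;> rintro ⟨i0, i1, i2, i3⟩ <;> refine ⟨?_, ?_, ?_, ?_⟩ <;> linarith
    all_goals linarith
  · rw [← isQuadrilateral_sqrt_iff_of_neg (p := p) (q := q) (r := r) (s := s), perm] <;> linarith

/-! ### Pauli channels that satisfy the polygon inequalities are anti-degradable -/

/-- The isometry `∑ k, x_k σ_k ⊗ |k⟩`. -/
def pauliIsometry (x : Fin 4 → ℂ) : Matrix (Fin 2 × Fin 4) (Fin 2) ℂ :=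
  Matrix.of fun p c => x p.2 * pauli p.2 p.1 c

/-- The Kraus operators of the degrading map: the basis vector `|k⟩` of the environment is sent to
the Bell state of `σ_k`, and the second qubit is discarded. -/
def bellKraus (f : Fin 2) : Matrix (Fin 2) (Fin 4) ℂ :=
  ((√2 : ℝ) : ℂ)⁻¹ • Matrix.of fun b k => pauli k b f

theorem inv_sqrt_two_mul_self : ((√2 : ℝ) : ℂ)⁻¹ * star ((√2 : ℝ) : ℂ)⁻¹ = 1 / 2 := by
  rw [star_inv₀, Complex.star_def, Complex.conj_ofReal, ← mul_inv, ← Complex.ofReal_mul,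
    Real.mul_self_sqrt (by norm_num)]
  norm_num

theorem sum_bellKraus : ∑ f, (bellKraus f)ᴴ * bellKraus f = 1 := by
  simp only [bellKraus, Matrix.conjTranspose_smul, Matrix.smul_mul, Matrix.mul_smul, smul_smul,
    inv_sqrt_two_mul_self]
  ext i j
  fin_cases i <;> fin_cases j <;>
    simp [Matrix.mul_apply, Fin.sum_univ_two, pauli] <;> norm_num

theorem traceEnv_pauliIsometry (x : Fin 4 → ℂ) (ρ : Mat 2) :
    traceEnv (pauliIsometry x * ρ * (pauliIsometry x)ᴴ) =
      ∑ k, (x k * star (x k)) • (pauli k * ρ * pauli k) := by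
  ext i j
  simp only [traceEnv, pauliIsometry, conj_mul_apply, Matrix.of_apply, Matrix.sum_apply,
    Matrix.smul_apply, smul_eq_mul]
  refine Finset.sum_congr rfl fun k _ => ?_
  conv_rhs => rw [← congrArg (fun M => pauli k * ρ * M) (pauli_conjTranspose k)]
  simp only [Matrix.mul_apply, Matrix.conjTranspose_apply, star_mul', Finset.mul_sum,
    Finset.sum_mul]
  refine Finset.sum_congr rfl fun c _ => Finset.sum_congr rfl fun d _ => ?_
  ring

-- The hypothesis makes `∑ x_k σ_k ⊗ σ_k` vanish on the singlet, so exchanging the two output qubits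
-- changes nothing; discarding the first then gives the same state as discarding the second.
set_option maxHeartbeats 1000000 in
theorem krausMap_bellKraus_traceOut {x : Fin 4 → ℂ} (h : x 0 = x 1 + x 2 + x 3) (ρ : Mat 2) :
    krausMap bellKraus (traceOut (pauliIsometry x * ρ * (pauliIsometry x)ᴴ)) =
      ∑ k, (x k * star (x k)) • (pauli k * ρ * pauli k) := by
  simp only [krausMap_apply, bellKraus, Matrix.conjTranspose_smul, Matrix.smul_mul,
    Matrix.mul_smul, smul_smul, mul_comm _ (((√2 : ℝ) : ℂ)⁻¹), inv_sqrt_two_mul_self]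
  ext i j
  simp only [pauliIsometry, traceOut, Matrix.sum_apply, Matrix.mul_apply,
    Matrix.of_apply, Matrix.smul_apply, Matrix.conjTranspose_apply,
    Fin.sum_univ_two, Fin.sum_univ_four, star_mul', h, star_add]
  fin_cases i <;> fin_cases j <;> simp [pauli] <;> ring_nf <;>
    simp only [Complex.I_sq, Complex.I_pow_four] <;> ring

theorem isAntiDegradable_of_isQuadrilateral {a : Fin 4 → ℝ} (ha : ∀ k, 0 ≤ a k)
    (hsum : ∑ k, a k ^ 2 = 1) (h : IsQuadrilateral a) :
    IsAntiDegradable (pauliMap fun k => a k ^ 2) := by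
  obtain ⟨x, hx, hx0⟩ := exists_quadrilateral ha h
  have hsum' : ∑ k, x k * star (x k) = 1 := by
    simp only [hx, ← Complex.ofReal_sum, hsum, Complex.ofReal_one]
  refine ⟨4, ⟨⟨fun ρ => traceOut (pauliIsometry x * ρ * (pauliIsometry x)ᴴ), fun ρ τ => ?_⟩,
    fun c ρ => ?_⟩, ⟨pauliIsometry x, ?_, fun ρ => ?_, fun ρ => rfl⟩,
    krausMap bellKraus, krausMap_isChannel sum_bellKraus, ?_⟩
  · ext i j
    simp [traceOut, Matrix.mul_add, Matrix.add_mul, Finset.sum_add_distrib]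
  · ext i j
    simp [traceOut, Matrix.mul_smul, Matrix.smul_mul, mul_add]
  · rw [Fin.sum_univ_four] at hsum'
    ext i j
    fin_cases i <;> fin_cases j <;>
      simp [Matrix.mul_apply, Fintype.sum_prod_type, pauliIsometry, pauli, Fin.sum_univ_four] <;>
      ring_nf <;> simp only [Complex.I_sq] <;> simp at hsum' <;> linear_combination hsum'
  · rw [traceEnv_pauliIsometry, pauliMap_apply]
    simp only [hx]
  · ext1 ρ
    change krausMap bellKraus (traceOut (pauliIsometry x * ρ * (pauliIsometry x)ᴴ)) = _
    rw [krausMap_bellKraus_traceOut hx0, pauliMap_apply]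
    simp only [hx]

/-! ### Anti-degradable Pauli channels satisfy the polygon inequalities -/

/-- With `c` the entries of a square root of the extended state, the right side is the quadratic
form of a marginal. Lengths can thus be read off from the Choi matrix. -/
theorem sum_norm_sq_linear_combination {ι κ τ : Type*} [Fintype ι] [Fintype κ] [Fintype τ]
    (c : ι → κ → τ → ℂ) (f : κ → ℂ) :
    ((∑ p : ι × τ, ‖∑ i, c p.1 i p.2 * f i‖ ^ 2 : ℝ) : ℂ) =
      ∑ i, ∑ j, star (f i) * f j * ∑ t, ∑ r, star (c r i t) * c r j t := by
  have h : ∀ z : ℂ, ((‖z‖ ^ 2 : ℝ) : ℂ) = star z * z := fun z => by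
    rw [Complex.star_def, mul_comm, Complex.mul_conj, Complex.normSq_eq_norm_sq]
  simp only [Complex.ofReal_sum, h, star_sum, Finset.sum_mul_sum, Fintype.sum_prod_type]
  simp only [Finset.mul_sum]
  rw [Finset.sum_comm]
  calc _ = ∑ t, ∑ i, ∑ j, ∑ r, star (c r i t * f i) * (c r j t * f j) := by
        refine Finset.sum_congr rfl fun t _ => ?_
        rw [Finset.sum_comm]
        exact Finset.sum_congr rfl fun i _ => Finset.sum_comm
    _ = ∑ i, ∑ j, ∑ t, ∑ r, star (c r i t * f i) * (c r j t * f j) := by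
        rw [Finset.sum_comm]
        exact Finset.sum_congr rfl fun i _ => Finset.sum_comm
    _ = _ := by
        refine Finset.sum_congr rfl fun i _ => Finset.sum_congr rfl fun j _ =>
          Finset.sum_congr rfl fun t _ => Finset.sum_congr rfl fun r _ => ?_
        rw [star_mul']
        ring

/-- The Choi matrix of a Pauli channel, evaluated on the Bell vector of `σ_j`. -/
theorem sum_pauli_choi (p : Fin 4 → ℝ) (j : Fin 4) :
    ∑ x : Fin 2 × Fin 2, ∑ y : Fin 2 × Fin 2, star (pauli j x.2 x.1) * pauli j y.2 y.1 *
      (∑ k, p k * (pauli k x.2 x.1 * star (pauli k y.2 y.1))) = ((4 * p j : ℝ) : ℂ) := by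
  simp only [Fintype.sum_prod_type]
  fin_cases j <;> simp [pauli, Fin.sum_univ_four] <;> ring_nf

theorem sum_norm_sq_mulVec {n : Type*} [Fintype n] [DecidableEq n] {Q : Matrix n n ℂ}
    (hQ : Qᴴ * Q = 1) (u : n → ℂ) : ∑ b, ‖(Q *ᵥ u) b‖ ^ 2 = ∑ b, ‖u b‖ ^ 2 := by
  have h : ∀ v : n → ℂ, ((∑ b, ‖v b‖ ^ 2 : ℝ) : ℂ) = star v ⬝ᵥ v := fun v => by
    simp only [dotProduct, Complex.ofReal_sum, Pi.star_apply]
    refine Finset.sum_congr rfl fun b _ => ?_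
    rw [Complex.star_def, mul_comm, Complex.mul_conj, Complex.normSq_eq_norm_sq]
  apply Complex.ofReal_injective
  rw [h, h, Matrix.star_mulVec, Matrix.dotProduct_mulVec, Matrix.vecMul_vecMul, hQ,
    Matrix.vecMul_one]

theorem pauli_transpose_mul_star (j k : Fin 4) :
    ((pauli k).map star * (pauli j)ᵀ)ᴴ * ((pauli k).map star * (pauli j)ᵀ) = 1 := by
  have h : ∀ k, (pauli k).map star = (pauli k)ᵀ := fun k => by
    conv_rhs => rw [← pauli_conjTranspose k, Matrix.conjTranspose, Matrix.transpose_map,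
      Matrix.transpose_transpose]
  have h' : ∀ k, ((pauli k)ᵀ)ᴴ = (pauli k)ᵀ := fun k => by
    rw [← h, ← Matrix.conjTranspose_map _ (fun _ => rfl), pauli_conjTranspose]
  have h2 : ∀ k, (pauli k)ᵀ * (pauli k)ᵀ = 1 := fun k => by
    rw [← Matrix.transpose_mul, pauli_mul_self, Matrix.transpose_one]
  rw [h, Matrix.conjTranspose_mul, h', h', Matrix.mul_assoc, ← Matrix.mul_assoc ((pauli k)ᵀ), h2,
    one_mul, h2]

/-- Completeness of the Pauli matrices, in the form of a recoupling identity. -/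
theorem pauli_recoupling (c : Fin 2 × Fin 2 → Fin 2 → ℂ) (j : Fin 4) (b : Fin 2) :
    ∑ k, (((pauli k).map star * (pauli j)ᵀ) *ᵥ
      fun t => ∑ x : Fin 2 × Fin 2, c x t * pauli k x.2 x.1) b =
      2 * ∑ y : Fin 2 × Fin 2, c (y.1, b) y.2 * pauli j y.2 y.1 := by
  simp only [Matrix.mulVec, dotProduct, Fintype.sum_prod_type, Matrix.mul_apply,
    Matrix.map_apply, Matrix.transpose_apply, Fin.sum_univ_two, Fin.sum_univ_four]
  fin_cases b <;> fin_cases j <;> simp [pauli] <;> ring_nf <;> simp <;> ring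

/-- `u k` and `w j` are the components of `C` along Bell states of the two pairs that contain the
reference. Each marginal fixes their lengths at `2 * a k` and `2 * a j`. By `pauli_recoupling`, `2 •
w j` is the sum of the `v j k`, which are the `u k` rotated unitarily, and the triangle inequality
concludes. -/
theorem isQuadrilateral_of_gram {a : Fin 4 → ℝ} (ha : ∀ k, 0 ≤ a k) {ι : Type*} [Fintype ι]
    (C : Matrix ι ((Fin 2 × Fin 2) × Fin 2) ℂ)
    (h1 : ∀ x y : Fin 2 × Fin 2, ∑ t, ∑ r, star (C r (x, t)) * C r (y, t) =
      ∑ k, ((a k ^ 2 : ℝ) : ℂ) * (pauli k x.2 x.1 * star (pauli k y.2 y.1)))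
    (h2 : ∀ x y : Fin 2 × Fin 2,
      ∑ b, ∑ r, star (C r ((x.1, b), x.2)) * C r ((y.1, b), y.2) =
        ∑ k, ((a k ^ 2 : ℝ) : ℂ) * (pauli k x.2 x.1 * star (pauli k y.2 y.1))) :
    IsQuadrilateral a := by
  let u (k : Fin 4) : EuclideanSpace ℂ (ι × Fin 2) :=
    WithLp.toLp 2 fun p => ∑ x : Fin 2 × Fin 2, C p.1 (x, p.2) * pauli k x.2 x.1
  let w (j : Fin 4) : EuclideanSpace ℂ (ι × Fin 2) :=
    WithLp.toLp 2 fun p => ∑ x : Fin 2 × Fin 2, C p.1 ((x.1, p.2), x.2) * pauli j x.2 x.1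
  let v (j k : Fin 4) : EuclideanSpace ℂ (ι × Fin 2) :=
    WithLp.toLp 2 fun p => (((pauli k).map star * (pauli j)ᵀ) *ᵥ fun t => u k (p.1, t)) p.2
  have hnorm : ∀ (z : EuclideanSpace ℂ (ι × Fin 2)) (k : Fin 4),
      ((‖z‖ ^ 2 : ℝ) : ℂ) = ((4 * a k ^ 2 : ℝ) : ℂ) → ‖z‖ = 2 * a k := fun z k h => by
    have h := Complex.ofReal_injective h
    rw [← sq_eq_sq₀ (norm_nonneg _) (by linarith [ha k]), h]
    ring
  have hu : ∀ k, ‖u k‖ = 2 * a k := fun k => by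
    apply hnorm
    rw [EuclideanSpace.norm_sq_eq]
    refine (sum_norm_sq_linear_combination (fun r x t => C r (x, t))
      fun x => pauli k x.2 x.1).trans ?_
    simp only [h1]
    exact sum_pauli_choi (fun k => a k ^ 2) k
  have hw : ∀ j, ‖w j‖ = 2 * a j := fun j => by
    apply hnorm
    rw [EuclideanSpace.norm_sq_eq]
    have h := sum_norm_sq_linear_combination (κ := Fin 2 × Fin 2)
      (fun r x t => C r ((x.1, t), x.2)) fun x => pauli j x.2 x.1
    simp only [h2] at h
    refine h.trans ?_
    exact sum_pauli_choi (fun k => a k ^ 2) j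
  have hv : ∀ j k, ‖v j k‖ = 2 * a k := fun j k => by
    rw [← hu k, ← sq_eq_sq₀ (norm_nonneg _) (norm_nonneg _), EuclideanSpace.norm_sq_eq,
      EuclideanSpace.norm_sq_eq, Fintype.sum_prod_type, Fintype.sum_prod_type]
    exact Finset.sum_congr rfl fun r _ =>
      sum_norm_sq_mulVec (pauli_transpose_mul_star j k) fun t => u k (r, t)
  intro j
  have hsum : ∑ k, v j k = (2 : ℝ) • w j := by
    ext p
    have := pauli_recoupling (fun x t => C p.1 (x, t)) j p.2
    simpa [v, u, w] using this
  have := norm_sum_le Finset.univ (v j)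
  rw [hsum, norm_smul, hw] at this
  simp only [hv, ← Finset.mul_sum] at this
  norm_num at this
  linarith

theorem isQuadrilateral_of_extension {a : Fin 4 → ℝ} (ha : ∀ k, 0 ≤ a k)
    {X : Matrix ((Fin 2 × Fin 2) × Fin 2) ((Fin 2 × Fin 2) × Fin 2) ℂ} (hX : X.PosSemidef)
    (h1 : ∀ x y : Fin 2 × Fin 2, ∑ t, X (x, t) (y, t) =
      ∑ k, ((a k ^ 2 : ℝ) : ℂ) * (pauli k x.2 x.1 * star (pauli k y.2 y.1)))
    (h2 : ∀ x y : Fin 2 × Fin 2, ∑ b, X ((x.1, b), x.2) ((y.1, b), y.2) =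
      ∑ k, ((a k ^ 2 : ℝ) : ℂ) * (pauli k x.2 x.1 * star (pauli k y.2 y.1))) :
    IsQuadrilateral a := by
  obtain ⟨C, rfl⟩ : ∃ C, X = Cᴴ * C := by
    open scoped MatrixOrder in
    exact CStarAlgebra.nonneg_iff_eq_star_mul_self.mp hX.nonneg
  exact isQuadrilateral_of_gram ha C h1 h2

theorem isQuadrilateral_of_isAntiDegradable {a : Fin 4 → ℝ} (ha : ∀ k, 0 ≤ a k)
    (h : IsAntiDegradable (pauliMap fun k => a k ^ 2)) : IsQuadrilateral a := by
  obtain ⟨e, Φc, ⟨W, -, hΦ, hΦc⟩, Ψ, hΨ, hcomp⟩ := h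
  let g : Fin 2 × Fin 2 ≃ Fin (2 * 2) := finProdFinEquiv
  -- The vector of the isometry applied to half of an entangled pair. Reference and output are
  -- flattened into `Fin (2 * 2)` so that `Ψ` acts on the environment alone.
  let y : Fin (2 * 2) × Fin e → ℂ := fun p => W ((g.symm p.1).2, p.2) (g.symm p.1).1
  let block (x z : Fin 2 × Fin 2) : Mat e :=
    Matrix.of fun s t => W (x.2, s) x.1 * star (W (z.2, t) z.1)
  have hX := (hΨ.completelyPositive (2 * 2) _ (Matrix.posSemidef_vecMulVec_self_star y)).submatrix
    fun p : (Fin 2 × Fin 2) × Fin 2 => (g p.1, p.2)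
  have hXe : ∀ x z t t', (ampliation Ψ (2 * 2) (Matrix.vecMulVec y (star y))).submatrix
      (fun p : (Fin 2 × Fin 2) × Fin 2 => (g p.1, p.2))
      (fun p : (Fin 2 × Fin 2) × Fin 2 => (g p.1, p.2)) (x, t) (z, t') =
      Ψ (block x z) t t' := by
    intro x z t t'
    simp only [Matrix.submatrix_apply, ampliation, Matrix.of_apply]
    refine congrArg (fun M => Ψ M t t') ?_
    ext s s'
    simp [block, y, Matrix.vecMulVec]
  have hW : ∀ (c d : Fin 2) (p q : Fin 2 × Fin e),
      (W * (Matrix.single c d 1 : Mat 2) * Wᴴ) p q = W p c * star (W q d) := fun c d p q => by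
    rw [conj_mul_apply]
    simp [Matrix.single_apply, ite_and]
  refine isQuadrilateral_of_extension ha hX (fun x z => ?_) fun x z => ?_
  -- Discarding the new output leaves the Choi matrix since `Ψ` preserves the trace; discarding the
  -- original one does so since `Ψ ∘ₗ Φc = Φ`.
  · simp only [hXe]
    change (Ψ (block x z)).trace = _
    rw [hΨ.tracePreserving, ← pauliMap_entry (fun k => a k ^ 2) x.1 z.1, hΦ]
    simp [traceEnv, hW, block, Matrix.trace]
  · simp only [hXe]
    rw [← pauliMap_entry (fun k => a k ^ 2) x.1 z.1, ← hcomp, LinearMap.comp_apply, hΦc,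
      ← Matrix.sum_apply, ← map_sum]
    refine congrArg (fun M => Ψ M x.2 z.2) ?_
    ext s t
    simp [traceOut, hW, block, Matrix.sum_apply]

/-! ### Unital qubit channels are represented by multipliers -/

/-- The real singular value decomposition, with respect to orthonormal bases. -/
theorem exists_singular_bases (T : EuclideanSpace ℝ (Fin 3) →ₗ[ℝ] EuclideanSpace ℝ (Fin 3)) :
    ∃ (u v : OrthonormalBasis (Fin 3) ℝ (EuclideanSpace ℝ (Fin 3))) (l : Fin 3 → ℝ),
      ∀ k, T (v k) = l k • u k := by
  have hn : Module.finrank ℝ (EuclideanSpace ℝ (Fin 3)) = 3 := by simp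
  have hn' : Module.finrank ℝ (EuclideanSpace ℝ (Fin 3)) = Fintype.card (Fin 3) := by simp
  have hS := T.isSymmetric_adjoint_mul_self
  set v := hS.eigenvectorBasis hn
  have horth : Pairwise fun i j => inner ℝ (T (v i)) (T (v j)) = 0 := fun i j hij => by
    change inner ℝ (T (v i)) (T (v j)) = 0
    rw [← LinearMap.adjoint_inner_right]
    have : LinearMap.adjoint T (T (v j)) = hS.eigenvalues hn j • v j :=
      hS.apply_eigenvectorBasis hn j
    rw [this, inner_smul_right, v.orthonormal.inner_eq_zero hij, mul_zero]
  -- The images of the eigenvectors of `T† T` are already orthogonal, so Gram–Schmidt only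
  -- normalises them and fills in directions where the image is zero.
  refine ⟨InnerProductSpace.gramSchmidtOrthonormalBasis hn' fun i => T (v i), v,
    fun i => ‖T (v i)‖, fun k => ?_⟩
  by_cases hk : T (v k) = 0
  · simp [hk]
  · rw [InnerProductSpace.gramSchmidtOrthonormalBasis_apply_of_orthogonal hn' horth hk]
    simp [smul_smul, norm_ne_zero_iff.2 hk]

/-- The traceless Hermitian matrix `∑ k, w_k σ_k`. -/
def pauliVec (w : Fin 3 → ℝ) : Mat 2 := ∑ k : Fin 3, (w k : ℂ) • pauli k.succ

theorem pauliVec_eq (w : Fin 3 → ℝ) :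
    pauliVec w = !![(w 2 : ℂ), w 0 - w 1 * Complex.I; w 0 + w 1 * Complex.I, -w 2] := by
  ext i j
  fin_cases i <;> fin_cases j <;> simp [pauliVec, pauli, Fin.sum_univ_three, sub_eq_add_neg]

theorem pauliVec_conjTranspose (w : Fin 3 → ℝ) : (pauliVec w)ᴴ = pauliVec w := by
  rw [pauliVec_eq]
  ext i j
  fin_cases i <;> fin_cases j <;> simp [sub_eq_add_neg]

theorem pauliVec_anticommutator (v w : Fin 3 → ℝ) :
    pauliVec v * pauliVec w + pauliVec w * pauliVec v =
      ((2 * ∑ k, v k * w k : ℝ) : ℂ) • (1 : Mat 2) := by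
  rw [pauliVec_eq, pauliVec_eq]
  ext i j
  fin_cases i <;> fin_cases j <;> simp [Fin.sum_univ_three] <;> ring_nf <;>
    simp only [Complex.I_sq] <;> ring

/-- Up to normalisation, `pauliVec w + pauli 3` is the half-turn about the bisector of `w` and the
third axis. The bisector degenerates only for the antipode, where `σ_1` serves. -/
theorem exists_unitary_sigma_three {w : Fin 3 → ℝ} (hw : ∑ k, w k * w k = 1) :
    ∃ V : Mat 2, Vᴴ * V = 1 ∧ V * pauli 3 * Vᴴ = pauliVec w := by
  rw [Fin.sum_univ_three] at hw
  by_cases h : w 2 = -1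
  · have h0 : w 0 = 0 := by nlinarith [sq_nonneg (w 0), sq_nonneg (w 1)]
    have h1 : w 1 = 0 := by nlinarith [sq_nonneg (w 0), sq_nonneg (w 1)]
    refine ⟨pauli 1, by rw [pauli_conjTranspose, pauli_mul_self], ?_⟩
    rw [pauli_conjTranspose, pauliVec_eq, h, h0, h1]
    ext i j
    fin_cases i <;> fin_cases j <;> simp [pauli, Matrix.mul_apply, Fin.sum_univ_two]
  · have hpos : 0 < 2 + 2 * w 2 := by
      have : -1 ≤ w 2 := by nlinarith [sq_nonneg (w 0), sq_nonneg (w 1)]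
      have := lt_of_le_of_ne this (Ne.symm h)
      linarith
    have hs2 := Real.sq_sqrt hpos.le
    have hs0 : ((√(2 + 2 * w 2) : ℝ) : ℂ) ≠ 0 :=
      Complex.ofReal_ne_zero.2 (Real.sqrt_pos.2 hpos).ne'
    have hsC : ((√(2 + 2 * w 2) : ℝ) : ℂ) ^ 2 = 2 + 2 * w 2 := by exact_mod_cast hs2
    have hwC : (w 0 : ℂ) * w 0 + w 1 * w 1 + w 2 * w 2 = 1 := by exact_mod_cast hw
    set s : ℂ := ((√(2 + 2 * w 2) : ℝ) : ℂ)
    have hstar : star s⁻¹ = s⁻¹ := by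
      rw [star_inv₀, Complex.star_def, Complex.conj_ofReal]
    set N := pauliVec w + pauli 3 with hN
    have hNH : Nᴴ = N := by
      rw [hN, Matrix.conjTranspose_add, pauliVec_conjTranspose, pauli_conjTranspose]
    have hinv : s⁻¹ * s⁻¹ * (2 + 2 * w 2) = 1 := by
      rw [← hsC]
      field_simp
    have hNN : N * N = (2 + 2 * w 2 : ℂ) • (1 : Mat 2) := by
      rw [hN, pauliVec_eq]
      ext i j
      fin_cases i <;> fin_cases j <;> simp [pauli, Matrix.mul_apply, Fin.sum_univ_two] <;>
        ring_nf <;> simp only [Complex.I_sq] <;> linear_combination hwC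
    have hNsN : N * pauli 3 * N = (2 + 2 * w 2 : ℂ) • pauliVec w := by
      rw [hN, pauliVec_eq]
      ext i j
      fin_cases i <;> fin_cases j <;> simp [pauli, Matrix.mul_apply, Fin.sum_univ_two]
      · ring_nf
        simp only [Complex.I_sq]
        linear_combination -hwC
      · ring
      · ring
      · ring_nf
        simp only [Complex.I_sq]
        linear_combination hwC
    refine ⟨s⁻¹ • N, ?_, ?_⟩
    · rw [Matrix.conjTranspose_smul, hNH, hstar, Matrix.smul_mul, Matrix.mul_smul, smul_smul, hNN,
        smul_smul, hinv, one_smul]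
    · rw [Matrix.conjTranspose_smul, hNH, hstar, Matrix.smul_mul, Matrix.smul_mul,
        Matrix.mul_smul, smul_smul, hNsN, smul_smul, hinv, one_smul]

/-- A Hermitian involution that anticommutes with `σ_3` is the conjugate of `σ_1` by a diagonal
unitary. -/
theorem exists_diagonal_unitary {H : Mat 2} (hH : Hᴴ = H) (h2 : H * H = 1)
    (h : H * pauli 3 + pauli 3 * H = 0) :
    ∃ D : Mat 2, Dᴴ * D = 1 ∧ D * pauli 3 * Dᴴ = pauli 3 ∧ D * pauli 1 * Dᴴ = H := by
  have e00 := congrFun (congrFun h 0) 0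
  have e11 := congrFun (congrFun h 1) 1
  have f00 := congrFun (congrFun h2 0) 0
  have g01 := congrFun (congrFun hH 0) 1
  simp [pauli, Matrix.mul_apply, Fin.sum_univ_two, Matrix.vecMul, dotProduct] at e00 e11 f00 g01
  rw [e00] at f00
  refine ⟨!![1, 0; 0, H 1 0], ?_, ?_, ?_⟩
  all_goals
    ext i j
    fin_cases i <;> fin_cases j <;>
      simp [pauli, Matrix.mul_apply, Fin.sum_univ_two, e00, e11, g01] <;>
      linear_combination f00

/-- An involution that anticommutes with `σ_1` and `σ_3` is `±σ_2`. -/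
theorem eq_or_eq_neg_sigma_two {K : Mat 2} (h2 : K * K = 1) (h1 : K * pauli 1 + pauli 1 * K = 0)
    (h3 : K * pauli 3 + pauli 3 * K = 0) : ∃ ε : ℝ, ε * ε = 1 ∧ pauli 2 = (ε : ℂ) • K := by
  have e00 := congrFun (congrFun h3 0) 0
  have e11 := congrFun (congrFun h3 1) 1
  have d00 := congrFun (congrFun h1 0) 0
  have f00 := congrFun (congrFun h2 0) 0
  simp [pauli, Matrix.mul_apply, Fin.sum_univ_two, Matrix.vecMul, dotProduct] at e00 e11 d00 f00
  have d10 : K 1 0 = -K 0 1 := by linear_combination d00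
  rw [e00, d10] at f00
  have hfac : (K 0 1 - Complex.I) * (K 0 1 + Complex.I) = 0 := by
    have := Complex.I_sq
    linear_combination -f00 - this
  rcases mul_eq_zero.1 hfac with h | h
  · refine ⟨-1, by norm_num, ?_⟩
    have h := sub_eq_zero.1 h
    ext i j
    fin_cases i <;> fin_cases j <;> simp [pauli, e00, e11, d10, h]
  · refine ⟨1, by norm_num, ?_⟩
    have h := eq_neg_of_add_eq_zero_left h
    ext i j
    fin_cases i <;> fin_cases j <;> simp [pauli, e00, e11, d10, h]

/-- Orthonormal frames of `ℝ³` are, up to signs, the images of the standard frame under unitary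
conjugations. -/
theorem exists_unitary_frame (u : OrthonormalBasis (Fin 3) ℝ (EuclideanSpace ℝ (Fin 3))) :
    ∃ (U : Mat 2) (ε : Fin 3 → ℝ), Uᴴ * U = 1 ∧ (∀ k, ε k * ε k = 1) ∧
      ∀ k, U * pauli k.succ * Uᴴ = (ε k : ℂ) • pauliVec (u k) := by
  have hdot : ∀ i j, ∑ k, u i k * u j k = if i = j then 1 else 0 := fun i j => by
    have := orthonormal_iff_ite.1 u.orthonormal j i
    rw [PiLp.inner_apply] at this
    simpa [eq_comm] using this
  have hac : ∀ i j, i ≠ j → pauliVec (u i) * pauliVec (u j) + pauliVec (u j) * pauliVec (u i) = 0 :=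
    fun i j hij => by rw [pauliVec_anticommutator, hdot, if_neg hij]; simp
  have hsq : ∀ i, pauliVec (u i) * pauliVec (u i) = 1 := fun i => by
    have h := pauliVec_anticommutator (u i) (u i)
    rw [hdot, if_pos rfl, ← two_smul ℂ] at h
    apply smul_right_injective (Mat 2) (two_ne_zero : (2 : ℂ) ≠ 0)
    simpa using h
  obtain ⟨V, hV, hV3⟩ := exists_unitary_sigma_three (w := u 2) (by rw [hdot, if_pos rfl])
  have hV' : V * Vᴴ = 1 := mul_eq_one_comm.1 hV
  have conjMul : ∀ {W : Mat 2}, W * Wᴴ = 1 → ∀ A B : Mat 2,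
      (Wᴴ * A * W) * (Wᴴ * B * W) = Wᴴ * (A * B) * W := fun {W} hW A B => by
    calc _ = Wᴴ * A * (W * Wᴴ) * B * W := by simp only [Matrix.mul_assoc]
      _ = _ := by rw [hW, mul_one]; simp only [Matrix.mul_assoc]
  have back : ∀ {W : Mat 2}, Wᴴ * W = 1 → ∀ {A B : Mat 2}, W * A * Wᴴ = B → Wᴴ * B * W = A :=
    fun {W} hW {A B} h => by
      rw [← h]
      calc _ = (Wᴴ * W) * A * (Wᴴ * W) := by simp only [Matrix.mul_assoc]
        _ = A := by rw [hW, one_mul, mul_one]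
  have forth : ∀ {W : Mat 2}, W * Wᴴ = 1 → ∀ {A : Mat 2}, W * (Wᴴ * A * W) * Wᴴ = A :=
    fun {W} hW {A} => by
      calc _ = (W * Wᴴ) * A * (W * Wᴴ) := by simp only [Matrix.mul_assoc]
        _ = A := by rw [hW, one_mul, mul_one]
  have hV3' := back hV hV3
  -- Once `V` has aligned the third axis, a diagonal unitary aligns the first without disturbing it.
  obtain ⟨D, hD, hD3, hD1⟩ := exists_diagonal_unitary (H := Vᴴ * pauliVec (u 0) * V)
    (by simp only [Matrix.conjTranspose_mul, Matrix.conjTranspose_conjTranspose,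
      pauliVec_conjTranspose, Matrix.mul_assoc])
    (by rw [conjMul hV', hsq, mul_one, hV])
    (by
      rw [← hV3', conjMul hV', conjMul hV', ← Matrix.add_mul, ← Matrix.mul_add,
        hac 0 2 (by decide), Matrix.mul_zero, Matrix.zero_mul])
  have hU : (V * D)ᴴ * (V * D) = 1 := by
    rw [Matrix.conjTranspose_mul]
    calc _ = Dᴴ * (Vᴴ * V) * D := by simp only [Matrix.mul_assoc]
      _ = 1 := by rw [hV, mul_one, hD]
  have hU' : (V * D) * (V * D)ᴴ = 1 := mul_eq_one_comm.1 hU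
  have hU3 : (V * D) * pauli 3 * (V * D)ᴴ = pauliVec (u 2) := by
    rw [Matrix.conjTranspose_mul]
    calc _ = V * (D * pauli 3 * Dᴴ) * Vᴴ := by simp only [Matrix.mul_assoc]
      _ = _ := by rw [hD3, hV3]
  have hU1 : (V * D) * pauli 1 * (V * D)ᴴ = pauliVec (u 0) := by
    rw [Matrix.conjTranspose_mul]
    calc _ = V * (D * pauli 1 * Dᴴ) * Vᴴ := by simp only [Matrix.mul_assoc]
      _ = _ := by rw [hD1, forth hV']
  set U := V * D
  obtain ⟨ε, hε, hε2⟩ := eq_or_eq_neg_sigma_two (K := Uᴴ * pauliVec (u 1) * U)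
    (by rw [conjMul hU', hsq, mul_one, hU])
    (by
      rw [← back hU hU1, conjMul hU', conjMul hU', ← Matrix.add_mul, ← Matrix.mul_add,
        hac 1 0 (by decide), Matrix.mul_zero, Matrix.zero_mul])
    (by
      rw [← back hU hU3, conjMul hU', conjMul hU', ← Matrix.add_mul, ← Matrix.mul_add,
        hac 1 2 (by decide), Matrix.mul_zero, Matrix.zero_mul])
  -- The sign is -1 for a left-handed frame, because unitary conjugations act on Bloch vectors by
  -- rotations only.
  refine ⟨U, ![1, ε, 1], hU, ?_, ?_⟩
  · intro k
    fin_cases k <;> simp [hε]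
  · intro k
    fin_cases k
    · simpa using hU1
    · change U * pauli 2 * Uᴴ = (ε : ℂ) • pauliVec (u 1)
      rw [hε2, Matrix.mul_smul, Matrix.smul_mul, forth hU']
    · simpa using hU3

/-- A positive Choi matrix is Hermitian, which is this identity on matrix units. -/
theorem map_conjTranspose_of_completelyPositive {n : ℕ} {Φ : Mat 2 →ₗ[ℂ] Mat n}
    (h : IsCompletelyPositive Φ) (ρ : Mat 2) : Φ ρᴴ = (Φ ρ)ᴴ := by
  have hH := (h 2 _ entangled_posSemidef).isHermitian
  have hs : ∀ i j, Φ (Matrix.single j i 1) = (Φ (Matrix.single i j 1))ᴴ := fun i j => by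
    ext a b
    have := congrFun (congrFun hH (j, a)) (i, b)
    rw [Matrix.conjTranspose_apply, ampliation_entangled, ampliation_entangled] at this
    rw [Matrix.conjTranspose_apply]
    exact this.symm
  conv_lhs => rw [Matrix.matrix_eq_sum_single ρᴴ]
  conv_rhs => rw [Matrix.matrix_eq_sum_single ρ]
  have hsm : ∀ (i j : Fin 2) (c : ℂ), Matrix.single i j c = c • Matrix.single i j (1 : ℂ) :=
    fun i j c => by rw [Matrix.smul_single, smul_eq_mul, mul_one]
  simp only [map_sum, Matrix.conjTranspose_sum]
  rw [Finset.sum_comm]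
  refine Finset.sum_congr rfl fun i _ => Finset.sum_congr rfl fun j _ => ?_
  rw [hsm, hsm i j, map_smul, map_smul, Matrix.conjTranspose_smul, hs i j,
    Matrix.conjTranspose_apply]

/-- A traceless Hermitian `2 × 2` matrix is a real combination of the Pauli matrices. -/
theorem exists_pauliVec {M : Mat 2} (hM : Mᴴ = M) (htr : M.trace = 0) :
    ∃ w : Fin 3 → ℝ, M = pauliVec w := by
  have h00 := congrFun (congrFun hM 0) 0
  have h10 := congrFun (congrFun hM 1) 0
  simp only [Matrix.conjTranspose_apply, Complex.star_def] at h00 h10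
  rw [Matrix.trace_fin_two] at htr
  have r00 := Complex.conj_eq_iff_re.1 h00
  refine ⟨![(M 1 0).re, (M 1 0).im, (M 0 0).re], ?_⟩
  rw [pauliVec_eq]
  have h01 : M 0 1 = (M 1 0).re - (M 1 0).im * Complex.I := by
    rw [← Complex.conj_conj (M 0 1), h10]
    apply Complex.ext <;> simp
  ext i j
  fin_cases i <;> fin_cases j
  · simp [r00]
  · simpa using h01
  · simp [Complex.re_add_im]
  · simp only [Matrix.cons_val, Fin.mk_one, Matrix.of_apply, r00]
    exact eq_neg_of_add_eq_zero_right htr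

theorem pauliVec_sum_smul {κ : Type*} [Fintype κ] (c : κ → ℝ) (w : κ → Fin 3 → ℝ) :
    pauliVec (∑ k, c k • w k) = ∑ k, (c k : ℂ) • pauliVec (w k) := by
  simp only [pauliVec, Finset.sum_apply, Pi.smul_apply, smul_eq_mul, Complex.ofReal_sum,
    Complex.ofReal_mul, Finset.sum_smul, Finset.smul_sum, smul_smul]
  exact Finset.sum_comm

theorem exists_hasMultipliers {Φ : Mat 2 →ₗ[ℂ] Mat 2} (h : IsUnitalQubitChannel Φ) :
    ∃ l, HasMultipliers Φ l := by
  have hpv : ∀ k : Fin 3, ∃ w : Fin 3 → ℝ, Φ (pauli k.succ) = pauliVec w := fun k => by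
    apply exists_pauliVec
    · rw [← map_conjTranspose_of_completelyPositive h.isChannel.completelyPositive,
        pauli_conjTranspose]
    · rw [h.isChannel.tracePreserving]
      fin_cases k <;> simp [pauli, Matrix.trace_fin_two]
  choose t ht using hpv
  let T : EuclideanSpace ℝ (Fin 3) →ₗ[ℝ] EuclideanSpace ℝ (Fin 3) :=
    { toFun := fun w => WithLp.toLp 2 (∑ k, w k • t k)
      map_add' := fun v w => by
        ext i
        simp [add_mul, Finset.sum_add_distrib]
      map_smul' := fun c w => by
        ext i
        simp [Finset.mul_sum, mul_assoc] }
  have hT : ∀ w : EuclideanSpace ℝ (Fin 3), Φ (pauliVec w) = pauliVec (T w) := fun w => by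
    have : pauliVec (T w) = pauliVec (∑ k, w k • t k) := rfl
    rw [this, pauliVec_sum_smul, pauliVec, map_sum]
    simp only [map_smul, ht]
  obtain ⟨u, v, l, hl⟩ := exists_singular_bases T
  obtain ⟨U, ε, hU, hε, hUk⟩ := exists_unitary_frame u
  obtain ⟨V, δ, hV, -, hVk⟩ := exists_unitary_frame v
  have hU' : U * Uᴴ = 1 := mul_eq_one_comm.1 hU
  have hV' : V * Vᴴ = 1 := mul_eq_one_comm.1 hV
  -- The orientation signs of both frames are absorbed into the multipliers, which may therefore be
  -- negative.
  have hkey : ∀ k : Fin 3, Φ (V * pauli k.succ * Vᴴ) =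
      ((δ k * l k * ε k : ℝ) : ℂ) • (U * pauli k.succ * Uᴴ) := fun k => by
    have hs : pauliVec (l k • u k : EuclideanSpace ℝ (Fin 3)) = (l k : ℂ) • pauliVec (u k) := by
      simp only [pauliVec, PiLp.smul_apply, smul_eq_mul, Complex.ofReal_mul, Finset.smul_sum,
        smul_smul]
    have hεk : (ε k : ℂ) * ε k = 1 := by exact_mod_cast hε k
    rw [hVk, map_smul, hT, hl, hs, hUk, smul_smul, smul_smul]
    congr 1
    push_cast
    linear_combination (-(δ k : ℂ) * l k) * hεk
  refine ⟨fun k => δ k * l k * ε k, U, Matrix.mem_unitaryGroup_iff'.2 hU, V,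
    Matrix.mem_unitaryGroup_iff'.2 hV, fun w => ?_⟩
  have hb : ∀ (W : Mat 2), W * Wᴴ = 1 → ∀ w : Fin 3 → ℝ, W * bloch w * Wᴴ =
      (1 / 2 : ℂ) • (1 + ∑ k : Fin 3, (w k : ℂ) • (W * pauli k.succ * Wᴴ)) := fun W hW w => by
    simp only [bloch, Matrix.mul_smul, Matrix.smul_mul, Matrix.mul_add, Matrix.add_mul,
      Matrix.mul_one, hW, Matrix.mul_sum, Matrix.sum_mul]
  rw [hb V hV', hb U hU', map_smul, map_add, h.unital, map_sum]
  simp only [map_smul, hkey, smul_smul]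
  congr 2
  refine Finset.sum_congr rfl fun k _ => ?_
  congr 1
  push_cast
  ring

/-! ### The criteria -/

theorem pauliMap_isAntiDegradable_iff {a : Fin 4 → ℝ} (ha : ∀ k, 0 ≤ a k)
    (hsum : ∑ k, a k ^ 2 = 1) :
    IsAntiDegradable (pauliMap fun k => a k ^ 2) ↔ IsQuadrilateral a :=
  ⟨isQuadrilateral_of_isAntiDegradable ha, isAntiDegradable_of_isQuadrilateral ha hsum⟩

theorem isAntiDegradable_iff_of_hasKraus {Φ : Mat 2 →ₗ[ℂ] Mat 2} {a : Fin 4 → ℝ}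
    (ha : ∀ k, 0 ≤ a k) (hmax : ∀ k, a k ≤ a 0) (hsum : ∑ k, a k ^ 2 = 1)
    (hΦ : HasKraus Φ fun k => (a k : ℂ) • pauli k) :
    IsAntiDegradable Φ ↔
      1 / 2 ≤ a 1 ^ 2 + a 2 ^ 2 + a 3 ^ 2 + a 1 * a 2 + a 1 * a 3 + a 2 * a 3 := by
  have h : Φ = pauliMap fun k => a k ^ 2 := by
    ext1 ρ
    rw [hΦ ρ, pauliMap_apply]
    refine Finset.sum_congr rfl fun k _ => ?_
    rw [Matrix.conjTranspose_smul, pauli_conjTranspose, Matrix.smul_mul, Matrix.smul_mul,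
      Matrix.mul_smul, smul_smul, Complex.star_def, Complex.conj_ofReal, sq, Complex.ofReal_mul]
  rw [h, pauliMap_isAntiDegradable_iff ha hsum, isQuadrilateral_iff]
  rw [Fin.sum_univ_four] at hsum
  rw [← le_add_add_iff_of_sum_sq (ha 0) (ha 1) (ha 2) (ha 3) hsum]
  have := ha 1
  have := ha 2
  have := ha 3
  have := hmax 1
  have := hmax 2
  have := hmax 3
  exact ⟨fun h => h.1, fun h => ⟨h, by linarith, by linarith, by linarith⟩⟩

theorem isAntiDegradable_iff_of_hasMultipliers {Φ : Mat 2 →ₗ[ℂ] Mat 2} {l : Fin 3 → ℝ}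
    (hΦ : HasMultipliers Φ l) (hl : CPCondition l) :
    IsAntiDegradable Φ ↔ 2 ≤ multiplierSum l := by
  have hp := (cpCondition_iff l).1 hl
  have hsq : (fun k => √(pauliWeights l k) ^ 2) = pauliWeights l :=
    funext fun k => Real.sq_sqrt (hp k)
  have hsum : ∑ k, √(pauliWeights l k) ^ 2 = 1 :=
    (congrArg (fun f : Fin 4 → ℝ => ∑ k, f k) hsq).trans (sum_pauliWeights l)
  rw [isAntiDegradable_iff_pauliMap hΦ, ← isQuadrilateral_sqrt_weights_iff hp,
    ← pauliMap_isAntiDegradable_iff (fun k => Real.sqrt_nonneg _) hsum, hsq]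

end QubitChannel

end

theorem theorem3p4 :
    -- Kraus form
    (∀ (Φ : QubitChannel.Mat 2 →ₗ[ℂ] QubitChannel.Mat 2) (a : Fin 4 → ℝ),
      (∀ k, 0 ≤ a k) → (∀ k, a k ≤ a 0) → ∑ k, a k ^ 2 = 1 →
      QubitChannel.HasKraus Φ (fun k => (a k : ℂ) • QubitChannel.pauli k) →
      (QubitChannel.IsAntiDegradable Φ ↔
        1 / 2 ≤ a 1 ^ 2 + a 2 ^ 2 + a 3 ^ 2 + a 1 * a 2 + a 1 * a 3 + a 2 * a 3)) ∧
    -- multiplier form: an arbitrary unital qubit channel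
    (∀ Φ : QubitChannel.Mat 2 →ₗ[ℂ] QubitChannel.Mat 2,
      QubitChannel.IsUnitalQubitChannel Φ →
      (QubitChannel.IsAntiDegradable Φ ↔
        ∃ l : Fin 3 → ℝ, QubitChannel.HasMultipliers Φ l ∧ QubitChannel.CPCondition l ∧
          2 ≤ QubitChannel.multiplierSum l)) ∧
    -- multiplier form: the criterion for every choice of multipliers satisfying the CP condition
    (∀ (Φ : QubitChannel.Mat 2 →ₗ[ℂ] QubitChannel.Mat 2) (l : Fin 3 → ℝ),
      QubitChannel.HasMultipliers Φ l → QubitChannel.CPCondition l →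
      (QubitChannel.IsAntiDegradable Φ ↔ 2 ≤ QubitChannel.multiplierSum l)) := by
  refine ⟨fun Φ a ha hmax hsum hΦ =>
      QubitChannel.isAntiDegradable_iff_of_hasKraus ha hmax hsum hΦ,
    fun Φ hΦ => ⟨fun h => ?_, fun ⟨l, hl, hcp, hs⟩ =>
      (QubitChannel.isAntiDegradable_iff_of_hasMultipliers hl hcp).2 hs⟩,
    fun Φ l hΦ hl => QubitChannel.isAntiDegradable_iff_of_hasMultipliers hΦ hl⟩
  obtain ⟨l, hl⟩ := QubitChannel.exists_hasMultipliers hΦ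
  have hcp := QubitChannel.cpCondition_of_completelyPositive hl hΦ.isChannel.completelyPositive
  exact ⟨l, hl, hcp, (QubitChannel.isAntiDegradable_iff_of_hasMultipliers hl hcp).1 h⟩
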